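/- **Setting.** Let $n\in\{2,3\}$. A connected porous medium in $\mathbb R^n$ with flat fractures is decomposed into finitely many connected, pairwise disjoint, flat subdomains $\Omega^d_i$ of dimensions $0\le d\le n$ (rock, fractures, intersections of fractures, …). Each side of a lower-dimensional subdomain $\Omega_i^d$ that is adjacent to a subdomain of dimension $d+1$ is an interface $\Gamma^d_{ij}$, and any two subdomains are linked by a chain of interfaces. $\Omega$ and $\Gamma$ are the unions of the subdomains and of the interfaces. A part of positive measure of the outer boundary carries Dirichlet conditions; on the rest of the outer boundary and at immersed fracture tips there is no flow. Every subdomain carries a simplicial mesh, and every interface carries its own, independent simplicial mesh. Let $\boldsymbol V_h$ be the space of lowest-order Raviart–Thomas fields on the subdomain meshes (tangential to the subdomains, with normal components continuous inside each subdomain and zero on no-flow facets), $\boldsymbol V_{0h}\subset\boldsymbol V_h$ the subspace of fields with zero normal component on $\Gamma$, $\Lambda_h$ and $Q_h$ the piecewise constants on the interface meshes and on the subdomain meshes, and $\boldsymbol W_h=\boldsymbol V_{0h}\times\Lambda_h$. Let $\boldsymbol\nu$ be the outward unit normal. The extension $R_h:\Lambda_h\to\boldsymbol V_h$ is determined by $R_h\mu\cdot\boldsymbol\nu=\widehat\Pi_h\mu$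 on $\Gamma$ and $R_h\mu\cdot\boldsymbol\nu=0$ on all other facets, where $\widehat\Pi_h$ is the $L^2$-projection onto the normal components of $\boldsymbol V_h$ on $\Gamma$ (constants on each facet). Put $[\![\mu]\!]|_{\Omega_i^d}=-\sum_j\mu_{ij}$, the sum over all interfaces of $\Omega_i^d$. Let the permeability $K$ be a symmetric positive definite tensor, constant on each subdomain, $K_\nu$ a scalar normal permeability on the interfaces that is bounded above and below by positive constants, and $\gamma>0$ constant on each interface. For $\boldsymbol w=[\boldsymbol u_0,\lambda]$, $\boldsymbol r=[\boldsymbol v_0,\mu]$ in $\boldsymbol W_h$ and $p\in Q_h$ let $$a(\boldsymbol w,\boldsymbol r)=(K^{-1}(\boldsymbol u_0+R_h\lambda),\boldsymbol v_0+R_h\mu)_\Omega+(\gamma K_\nu^{-1}\lambda,\mu)_\Gamma,\qquad b(\boldsymbol r,p)=-(p,\nabla\cdot(\boldsymbol v_0+R_h\mu)+[\![\mu]\!])_\Omega,$$ $$a^D(\boldsymbol w,\boldsymbol r)=\sum_{T}\sum_{f\subset\partial T}\big((\boldsymbol u_0+R_h\lambda)\cdot\boldsymbol\nu_f\big)\big((\boldsymbol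 v_0+R_h\mu)\cdot\boldsymbol\nu_f\big)(K^{-1}\boldsymbol\phi_f,\boldsymbol\phi_f)_T+(\gamma K_\nu^{-1}\lambda,\mu)_\Gamma,$$ where $T$ runs over all cells of all subdomain meshes, $f$ over the facets of $T$, and $\boldsymbol\phi_f$ is the Raviart–Thomas basis function on $T$ with normal component $1$ on $f$ and $0$ on the other facets. Let $A,D_A:\boldsymbol W_h\to\boldsymbol W_h'$ and $B:\boldsymbol W_h\to Q_h'$ be the operators of $a$, $a^D$, $b$, let $\boldsymbol D_h=D_A^{-1}B^T$, $\boldsymbol X=\boldsymbol W_h\times Q_h$, and $$\mathcal A=\begin{pmatrix}A&B^T\\-B&0\end{pmatrix},\qquad \mathcal B_D=\begin{pmatrix}A&0\\0&BD_A^{-1}B^T\end{pmatrix}^{-1},\qquad |||(\boldsymbol r,q)|||^2=a(\boldsymbol r,\boldsymbol r)+a^D(\boldsymbol D_hq,\boldsymbol D_hq),$$ $$\mathcal L(\boldsymbol w,p;\boldsymbol r,q)=a(\boldsymbol w,\boldsymbol r)+a^D(\boldsymbol D_hp,\boldsymbol r)+a^D(\boldsymbol D_hq,\boldsymbol w).$$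 Let $\kappa(T)=\|T\|\,\|T^{-1}\|$ with the operator norms induced by $|||\cdot|||$ on $\boldsymbol X$. **Theorem.** For all real $\sigma$ and $\tau$ there are constants $\alpha,\beta>0$, depending only on $\sigma$ and $\tau$, such that the following holds for all fractured media and meshes as above for which every cell $T$ of the subdomain meshes satisfies $\operatorname{diam}T\le\sigma\rho_T$, with $\rho_T$ the diameter of the largest ball inscribed in $T$, and all parameters $K,K_\nu,\gamma$ as above such that on each subdomain the largest eigenvalue of $K$ is at most $\tau$ times the smallest one ($\tau=1$ if $K$ is a scalar multiple of the identity on each subdomain): 1. $A$, $D_A$, $BD_A^{-1}B^T$ and $\mathcal A$ are invertible, and $|||\cdot|||$ is positive definite. 2. $|\mathcal L(\boldsymbol x;\boldsymbol y)|\le\alpha\,|||\boldsymbol x|||\,|||\boldsymbol y|||$ for all $\boldsymbol x,\boldsymbol y\in\boldsymbol X$, and $\displaystyle\inf_{\boldsymbol y\ne0}\sup_{\boldsymbol x\neq0}\frac{\mathcal L(\boldsymbol x;\boldsymbol y)}{|||\boldsymbol x|||\,|||\boldsymbol y|||}\ge\beta$. 3. $\kappa(\mathcal B_D\mathcal A)\le\alpha/\beta$;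 moreover $\kappa(\mathcal B_D\mathcal A)\le\alpha'/\beta'$ for any constants $\alpha',\beta'>0$ that satisfy the two inequalities in 2 in place of $\alpha,\beta$. In particular the bound is independent of the mesh size $h$, of the interface meshes, of the size and the jumps of $K$, and of $K_\nu$ and $\gamma$. -/

import Mathlib

open MeasureTheory

namespace MixedDim

noncomputable section

/-- The Euclidean space `ℝⁿ`. -/
abbrev E (n : ℕ) : Type := EuclideanSpace ℝ (Fin n)

/-! ### Simplices -/

/-- The closed simplex as a set. -/
def body {n d : ℕ} (s : Affine.Simplex ℝ (E n) d) : Set (E n) :=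
  convexHull ℝ (Set.range s.points)

/-- The facet of a simplex opposite to the vertex `k`, as a closed set
(empty for a simplex of dimension `0`). -/
def facet {n d : ℕ} (s : Affine.Simplex ℝ (E n) d) (k : Fin (d + 1)) : Set (E n) :=
  convexHull ℝ (s.points '' {k}ᶜ)

/-- The distance of the vertex `k` from the plane of the opposite facet. -/
def facetHeight {n d : ℕ} (s : Affine.Simplex ℝ (E n) d) (k : Fin (d + 1)) : ℝ :=
  if h : d = 0 then 0 else
    haveI : NeZero d := ⟨h⟩
    s.height k

/-- The unit normal of the facet opposite to the vertex `k`, tangential to the simplex and pointing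
out of it. -/
def outwardNormal {n d : ℕ} (s : Affine.Simplex ℝ (E n) d) (k : Fin (d + 1)) : E n :=
  if h : d = 0 then 0 else
    haveI : NeZero d := ⟨h⟩
    (s.height k)⁻¹ • (s.altitudeFoot k - s.points k)

/-- The barycentre of the facet opposite to the vertex `k`. -/
def facetBarycenter {n d : ℕ} (s : Affine.Simplex ℝ (E n) d) (k : Fin (d + 1)) : E n :=
  (d : ℝ)⁻¹ • ∑ j ∈ Finset.univ.erase k, s.points j

/-! ### Lowest order Raviart–Thomas fields on one simplex

A tangential vector field on a simplex whose plane has direction `D` is a map into `D`; it is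
extended to `ℝⁿ` so as to be constant along the normal directions of the plane. -/

/-- `RT₀` on a plane with direction `D` through `p`: the fields `x ↦ a + b (x - p)`. -/
def rtPoly {n : ℕ} (D : Submodule ℝ (E n)) (p : E n) : Submodule ℝ (E n → D) where
  carrier := {v | ∃ (a : D) (b : ℝ), ∀ x, v x = a + b • D.orthogonalProjectionOnto (x - p)}
  zero_mem' := ⟨0, 0, fun x => by simp⟩
  add_mem' := by
    rintro u v ⟨a, b, h⟩ ⟨a', b', h'⟩
    refine ⟨a + a', b + b', fun x => ?_⟩
    rw [Pi.add_apply, h, h', add_smul]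
    abel
  smul_mem' := by
    rintro c v ⟨a, b, h⟩
    refine ⟨c • a, c * b, fun x => ?_⟩
    rw [Pi.smul_apply, h, smul_add, mul_smul]

/-- The divergence of a tangential field: the trace of the tangential derivative. -/
def tangentialDiv {n : ℕ} {D : Submodule ℝ (E n)} (v : E n → D) (x : E n) : ℝ :=
  LinearMap.trace ℝ D ((fderiv ℝ v x).toLinearMap ∘ₗ D.subtype)

/-- The `RT₀` basis function of the facet opposite to the vertex `k`: its normal component is `1`
on that facet and `0` on the other ones. -/
def rtBasis {n d : ℕ} (D : Submodule ℝ (E n)) (s : Affine.Simplex ℝ (E n) d) (k : Fin (d + 1)) :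
    E n → D :=
  fun x => (facetHeight s k)⁻¹ • D.orthogonalProjectionOnto (x - s.points k)

/-! ### Fractured domains and their meshes -/

/-- The role of a facet of a cell. `C`, `F`, `I` are the types of cells, of facets of a cell, and of
interfaces. -/
inductive FacetKind (C F I : Type) : Type
  /-- shared with the facet `k'` of the cell `c'` of the same subdomain -/
  | interior (c' : C) (k' : F)
  /-- on the part of the outer boundary where the pressure is prescribed -/
  | dirichlet
  /-- no flow: on the rest of the outer boundary, or at an immersed tip of a fracture -/
  | neumann
  /-- on the interface `e` to a subdomain of one dimension less -/
  | mortar (e : I)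

/-- A fractured porous medium in `ℝⁿ` whose fractures, fracture intersections, etc. are flat,
decomposed into subdomains of dimensions `0, …, n`, with simplicial meshes of the subdomains and
independent simplicial meshes of the interfaces. The closure of a subdomain is the union of its
cells. An interface is one side of a lower-dimensional subdomain `low`, seen from an adjacent
subdomain `up` of one dimension more. -/
structure MixedDimMesh (n : ℕ) where
  /-- the subdomains `Ω_i^d`, of all dimensions `d` -/
  Sub : Type
  [subFintype : Fintype Sub]
  dim : Sub → ℕ
  dim_le : ∀ i, dim i ≤ n
  /-- the elements of the mesh of a subdomain -/
  Cell : Sub → Type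
  [cellFintype : ∀ i, Fintype (Cell i)]
  [cellNonempty : ∀ i, Nonempty (Cell i)]
  simplex : ∀ i, Cell i → Affine.Simplex ℝ (E n) (dim i)
  /-- the plane that contains a subdomain -/
  plane : Sub → AffineSubspace ℝ (E n)
  affineSpan_simplex : ∀ i c, affineSpan ℝ (Set.range (simplex i c).points) = plane i
  /-- cells do not overlap, and the subdomains are disjoint -/
  disjoint_cells : Pairwise fun s t : Σ i, Cell i =>
    Disjoint (intrinsicInterior ℝ (body (simplex s.1 s.2)))
      (intrinsicInterior ℝ (body (simplex t.1 t.2)))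
  /-- the interfaces `Γ_ij^d` -/
  Iface : Type
  [ifaceFintype : Fintype Iface]
  up : Iface → Sub
  low : Iface → Sub
  dim_up : ∀ e, dim (up e) = dim (low e) + 1
  /-- the role of the facet opposite to a vertex of a cell -/
  kind : ∀ i, Cell i → Fin (dim i + 1) → FacetKind (Cell i) (Fin (dim i + 1)) Iface
  /-- a point has no facets; this fixes a meaningless value -/
  kind_point : ∀ i c k, dim i = 0 → kind i c k = .neumann
  interior_symm : ∀ i c k c' k', kind i c k = .interior c' k' → kind i c' k' = .interior c k
  interior_shared : ∀ i c k c' k', kind i c k = .interior c' k' →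
    c ≠ c' ∧ facet (simplex i c) k = facet (simplex i c') k'
  /-- an interior facet lies inside its subdomain, so it meets no subdomain of lower dimension -/
  interior_avoids : ∀ i c k c' k', kind i c k = .interior c' k' → ∀ j, dim j < dim i →
    ∀ c'' : Cell j, Disjoint (intrinsicInterior ℝ (facet (simplex i c) k)) (body (simplex j c''))
  /-- Dirichlet facets lie on the boundary of the medium -/
  dirichlet_boundary : ∀ i c k, kind i c k = .dirichlet →
    facet (simplex i c) k ⊆
      frontier (⋃ (j : Sub) (_ : dim j = n) (c' : Cell j), body (simplex j c'))
  mortar_up : ∀ i c k e, kind i c k = .mortar e → i = up e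
  /-- the facets on an interface cover the lower-dimensional subdomain … -/
  mortar_cover : ∀ e,
    (⋃ (c : Cell (up e)) (k) (_ : kind (up e) c k = .mortar e), facet (simplex (up e) c) k) =
      ⋃ c' : Cell (low e), body (simplex (low e) c')
  /-- … once -/
  mortar_disjoint : ∀ e, Pairwise fun s t : {s : Cell (up e) × Fin (dim (up e) + 1) //
      kind (up e) s.1 s.2 = .mortar e} =>
    Disjoint (intrinsicInterior ℝ (facet (simplex (up e) s.1.1) s.1.2))
      (intrinsicInterior ℝ (facet (simplex (up e) t.1.1) t.1.2))
  /-- the elements of the mesh of an interface -/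
  MCell : Iface → Type
  [mcellFintype : ∀ e, Fintype (MCell e)]
  msimplex : ∀ e, MCell e → Affine.Simplex ℝ (E n) (dim (low e))
  msimplex_cover : ∀ e,
    (⋃ m : MCell e, body (msimplex e m)) = ⋃ c' : Cell (low e), body (simplex (low e) c')
  msimplex_disjoint : ∀ e, Pairwise fun m m' : MCell e =>
    Disjoint (intrinsicInterior ℝ (body (msimplex e m)))
      (intrinsicInterior ℝ (body (msimplex e m')))
  /-- every subdomain is connected: any two of its cells are joined by a chain of cells in which
  neighbours share an interior facet -/
  sub_connected : ∀ i (c c' : Cell i),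
    Relation.EqvGen (fun a b => ∃ k k', kind i a k = .interior b k') c c'
  /-- the medium is connected: any two subdomains are joined by a chain of interfaces -/
  connected : ∀ i j, Relation.EqvGen (fun a b => ∃ e, up e = a ∧ low e = b) i j
  /-- the Dirichlet part of the boundary of the medium has positive `(n-1)`-dimensional measure -/
  exists_dirichlet : ∃ i c k, dim i = n ∧ kind i c k = .dirichlet

attribute [instance] MixedDimMesh.subFintype MixedDimMesh.cellFintype MixedDimMesh.cellNonempty
  MixedDimMesh.ifaceFintype MixedDimMesh.mcellFintype

/-- The directions tangential to a subdomain. -/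
abbrev MixedDimMesh.dir {n : ℕ} (M : MixedDimMesh n) (i : M.Sub) : Submodule ℝ (E n) :=
  (M.plane i).direction

/-- Shape regularity with constant `σ`: the diameter of every cell of every subdomain is at most `σ`
times the diameter `2 r` of some ball inscribed in the cell. -/
def MixedDimMesh.ShapeRegular {n : ℕ} (M : MixedDimMesh n) (σ : ℝ) : Prop :=
  ∀ i (c : M.Cell i), ∃ z ∈ M.plane i, ∃ r : ℝ, 0 < r ∧
    Metric.closedBall z r ∩ (M.plane i : Set (E n)) ⊆ body (M.simplex i c) ∧
    Metric.diam (body (M.simplex i c)) ≤ σ * (2 * r)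

/-- The physical parameters. The tangential permeability `K` is a symmetric positive definite tensor,
constant on each subdomain; the normal permeability `Kν` is a measurable function on the interfaces,
bounded above and below by positive constants; `γ` is a positive constant on each interface. -/
structure Params {n : ℕ} (M : MixedDimMesh n) where
  K : ∀ i, M.dir i ≃ₗ[ℝ] M.dir i
  K_symm : ∀ i (u v : M.dir i), inner ℝ (K i u) v = inner ℝ u (K i v)
  K_pos : ∀ i (v : M.dir i), v ≠ 0 → 0 < inner ℝ (K i v) v
  Kν : M.Iface → E n → ℝ
  Kν_measurable : ∀ e, Measurable (Kν e)
  Kν_bounds : ∀ e, ∃ a b : ℝ, 0 < a ∧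
    ∀ m : M.MCell e, ∀ x ∈ body (M.msimplex e m), a ≤ Kν e x ∧ Kν e x ≤ b
  γ : M.Iface → ℝ
  γ_pos : ∀ e, 0 < γ e

/-- On each subdomain the ratio of the extreme eigenvalues of `K` is at most `τ`. -/
def Params.AnisotropyLE {n : ℕ} {M : MixedDimMesh n} (P : Params M) (τ : ℝ) : Prop :=
  ∀ i, ∃ κ : ℝ, 0 < κ ∧ ∀ v : M.dir i,
    κ * ‖v‖ ^ 2 ≤ inner ℝ (P.K i v) v ∧ inner ℝ (P.K i v) v ≤ τ * κ * ‖v‖ ^ 2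

/-! ### The discrete spaces -/

section Spaces

variable {n : ℕ} (M : MixedDimMesh n)

/-- Elementwise given tangential vector fields on all subdomains. -/
abbrev Field : Type := ∀ i, M.Cell i → E n → M.dir i

variable {M} in
/-- The outward normal component of a field at the facet `k` of the cell `c`. -/
def normalTrace (v : Field M) (i : M.Sub) (c : M.Cell i) (k : Fin (M.dim i + 1)) (x : E n) : ℝ :=
  inner ℝ (v i c x : E n) (outwardNormal (M.simplex i c) k)

/-- `V_h`: elementwise `RT₀` fields whose normal components are continuous across interior facets
and vanish on no-flow facets. There is no condition on Dirichlet facets and on interfaces. -/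
def V : Submodule ℝ (Field M) where
  carrier := {v |
    (∀ i c, v i c ∈ rtPoly (M.dir i) ((M.simplex i c).points 0)) ∧
    (∀ i c k c' k', M.kind i c k = .interior c' k' → ∀ x ∈ facet (M.simplex i c) k,
      normalTrace v i c k x + normalTrace v i c' k' x = 0) ∧
    (∀ i c k, M.kind i c k = .neumann → ∀ x ∈ facet (M.simplex i c) k,
      normalTrace v i c k x = 0)}
  zero_mem' := by
    refine ⟨fun i c => Submodule.zero_mem _, ?_, ?_⟩ <;> intros <;> simp [normalTrace]
  add_mem' := by
    rintro u v ⟨h1, h2, h3⟩ ⟨h1', h2', h3'⟩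
    refine ⟨fun i c => Submodule.add_mem _ (h1 i c) (h1' i c), ?_, ?_⟩
    · intro i c k c' k' hk x hx
      have a := h2 i c k c' k' hk x hx
      have b := h2' i c k c' k' hk x hx
      simp only [normalTrace, Pi.add_apply, Submodule.coe_add, inner_add_left] at a b ⊢
      linarith
    · intro i c k hk x hx
      have a := h3 i c k hk x hx
      have b := h3' i c k hk x hx
      simp only [normalTrace, Pi.add_apply, Submodule.coe_add, inner_add_left] at a b ⊢
      linarith
  smul_mem' := by
    rintro r v ⟨h1, h2, h3⟩
    refine ⟨fun i c => Submodule.smul_mem _ _ (h1 i c), ?_, ?_⟩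
    · intro i c k c' k' hk x hx
      have a := h2 i c k c' k' hk x hx
      simp only [normalTrace, Pi.smul_apply, Submodule.coe_smul, real_inner_smul_left] at a ⊢
      rw [← mul_add, a, mul_zero]
    · intro i c k hk x hx
      have a := h3 i c k hk x hx
      simp only [normalTrace, Pi.smul_apply, Submodule.coe_smul, real_inner_smul_left] at a ⊢
      rw [a, mul_zero]

/-- `V_{0h}`: the fields of `V_h` whose normal components vanish on all interfaces. -/
def V0 : Submodule ℝ (V M) where
  carrier := {v | ∀ i c k e, M.kind i c k = .mortar e → ∀ x ∈ facet (M.simplex i c) k,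
    normalTrace v.1 i c k x = 0}
  zero_mem' := by simp [normalTrace]
  add_mem' := by
    intro u v h h' i c k e hk x hx
    have a := h i c k e hk x hx
    have b := h' i c k e hk x hx
    simp only [normalTrace, Submodule.coe_add, Pi.add_apply, inner_add_left] at a b ⊢
    linarith
  smul_mem' := by
    intro r v h i c k e hk x hx
    have a := h i c k e hk x hx
    simp only [normalTrace, Submodule.coe_smul, Pi.smul_apply, real_inner_smul_left] at a ⊢
    rw [a, mul_zero]

/-- `Λ_h`: piecewise constants on the meshes of the interfaces. -/
abbrev Lam : Type := ∀ e, M.MCell e → ℝ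

/-- `Q_h`: piecewise constants on the meshes of the subdomains. -/
abbrev Q : Type := ∀ i, M.Cell i → ℝ

/-- `W_h = V_{0h} × Λ_h`. -/
abbrev W : Type := V0 M × Lam M

/-- `X = W_h × Q_h`. -/
abbrev X : Type := W M × Q M

variable {M}

/-- A mortar variable as a function on the interface `e` (zero off the interface). -/
def mortarFun (μ : Lam M) (e : M.Iface) (x : E n) : ℝ :=
  ∑ m, (body (M.msimplex e m)).indicator (fun _ => μ e m) x

open Classical in
/-- The jump `⟦μ⟧` on the subdomain `i`: minus the sum over the interfaces that lie on `i`. -/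
def jump (μ : Lam M) (i : M.Sub) (x : E n) : ℝ :=
  -∑ e, if M.low e = i then mortarFun μ e x else 0

/-- The value on the facet `f ⊆ e` of the `L²`-projection `Π̂_h μ` of a mortar variable onto the
facetwise constants (the normal components of `V_h` on the interface): the mean of `μ` over `f`. -/
def proj (μ : Lam M) (e : M.Iface) (f : Set (E n)) : ℝ :=
  ∑ m, μ e m * ((μHE[M.dim (M.low e)] : Measure (E n)).real (f ∩ body (M.msimplex e m)) /
    (μHE[M.dim (M.low e)] : Measure (E n)).real f)

/-- The normal component on the facet `k` of the cell `c` of the extension of a mortar variable. -/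
def extCoeff (μ : Lam M) (i : M.Sub) (c : M.Cell i) (k : Fin (M.dim i + 1)) : ℝ :=
  match M.kind i c k with
  | .mortar e => proj μ e (facet (M.simplex i c) k)
  | _ => 0

/-- The extension `R_h μ` as a field. -/
def extField (μ : Lam M) : Field M :=
  fun i c x => ∑ k, extCoeff μ i c k • rtBasis (M.dir i) (M.simplex i c) k x

/-! ### The extension operator -/

theorem facet_subset_body {d : ℕ} (s : Affine.Simplex ℝ (E n) d) (k : Fin (d + 1)) :
    facet s k ⊆ body s :=
  convexHull_mono (Set.image_subset_range _ _)

theorem body_subset_plane (i : M.Sub) (c : M.Cell i) :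
    body (M.simplex i c) ⊆ (M.plane i : Set (E n)) := by
  rw [← M.affineSpan_simplex i c]
  exact convexHull_subset_affineSpan _

theorem inner_sub_outwardNormal {d : ℕ} (s : Affine.Simplex ℝ (E n) d) (j k : Fin (d + 1))
    {x : E n} (hx : x ∈ facet s j) :
    inner ℝ (x - s.points k) (outwardNormal s j) = if k = j then facetHeight s j else 0 := by
  by_cases hd : d = 0
  · exfalso
    subst hd
    have : ({j}ᶜ : Set (Fin (0 + 1))) = ∅ := by
      ext a
      have h1 := a.2
      have h2 := j.2
      have : a = j := Fin.ext (by omega)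
      simp [this]
    simp [facet, this] at hx
  · have : NeZero d := ⟨hd⟩
    have key : ∀ y ∈ affineSpan ℝ (s.points '' {j}ᶜ),
        inner ℝ (y - s.altitudeFoot j) (s.altitudeFoot j - s.points j) = 0 := by
      intro y hy
      refine Submodule.inner_right_of_mem_orthogonal
        (K := vectorSpan ℝ (s.points '' {j}ᶜ))
        (vsub_mem_vectorSpan_of_mem_affineSpan_of_mem_affineSpan hy
          (Affine.Simplex.altitudeFoot_mem_affineSpan_image_compl _ _)) ?_
      rw [← direction_affineSpan, ← Affine.Simplex.range_faceOpposite_points]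
      exact EuclideanGeometry.orthogonalProjection_vsub_mem_direction_orthogonal _ _
    have hx' := key x (convexHull_subset_affineSpan _ hx)
    have hh : s.height j ≠ 0 := (s.height_pos j).ne'
    simp only [outwardNormal, facetHeight, hd, dif_neg, not_false_eq_true, real_inner_smul_right]
    split_ifs with hk
    · subst hk
      have e1 : x - s.points k = (x - s.altitudeFoot k) + (s.altitudeFoot k - s.points k) := by
        abel
      rw [e1, inner_add_left, hx', real_inner_self_eq_norm_sq, ← dist_eq_norm, dist_comm]
      change (s.height k)⁻¹ * (0 + s.height k ^ 2) = s.height k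
      field_simp
      ring
    · have e1 : x - s.points k = (x - s.altitudeFoot j) - (s.points k - s.altitudeFoot j) := by
        abel
      rw [e1, inner_sub_left, hx',
        key (s.points k) (mem_affineSpan ℝ (Set.mem_image_of_mem _ hk))]
      simp

/-- The normal components of the basis functions. -/
theorem inner_rtBasis (i : M.Sub) (c : M.Cell i) (j k : Fin (M.dim i + 1)) {x : E n}
    (hx : x ∈ facet (M.simplex i c) j) :
    inner ℝ (rtBasis (M.dir i) (M.simplex i c) k x : E n) (outwardNormal (M.simplex i c) j) =
      if k = j then 1 else 0 := by
  have hm : x - (M.simplex i c).points k ∈ M.dir i := by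
    refine AffineSubspace.vsub_mem_direction
      (body_subset_plane i c (facet_subset_body _ _ hx)) ?_
    exact body_subset_plane i c (subset_convexHull ℝ _ (Set.mem_range_self _))
  have hp : ((M.dir i).orthogonalProjectionOnto (x - (M.simplex i c).points k) : E n) =
      x - (M.simplex i c).points k :=
    Submodule.starProjection_eq_self_iff.2 hm
  have h0 : M.dim i ≠ 0 := by
    intro h0
    have : ({j}ᶜ : Set (Fin (M.dim i + 1))) = ∅ := by
      ext a
      have h1 := a.2
      have h2 := j.2
      have : a = j := Fin.ext (by omega)
      simp [this]
    simp [facet, this] at hx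
  rw [rtBasis, Submodule.coe_smul, hp, real_inner_smul_left, inner_sub_outwardNormal _ _ _ hx]
  split_ifs with hk
  · subst hk
    have : NeZero (M.dim i) := ⟨h0⟩
    have : facetHeight (M.simplex i c) k ≠ 0 := by
      simp only [facetHeight, h0, dif_neg, not_false_eq_true]
      exact (Affine.Simplex.height_pos _ _).ne'
    exact inv_mul_cancel₀ this
  · simp

theorem rtBasis_mem (D : Submodule ℝ (E n)) {d : ℕ} (s : Affine.Simplex ℝ (E n) d)
    (k : Fin (d + 1)) : rtBasis D s k ∈ rtPoly D (s.points 0) := by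
  refine ⟨(facetHeight s k)⁻¹ • D.orthogonalProjectionOnto (s.points 0 - s.points k),
    (facetHeight s k)⁻¹, fun x => ?_⟩
  rw [rtBasis, ← smul_add, ← map_add]
  congr 2
  abel

/-- `R_h μ` has the normal component `Π̂_h μ` on the interfaces and `0` on all other facets. -/
theorem normalTrace_extField (μ : Lam M) (i : M.Sub) (c : M.Cell i) (k : Fin (M.dim i + 1))
    {x : E n} (hx : x ∈ facet (M.simplex i c) k) :
    normalTrace (extField μ) i c k x = extCoeff μ i c k := by
  simp only [normalTrace, extField, Submodule.coe_sum, Submodule.coe_smul, sum_inner,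
    real_inner_smul_left, inner_rtBasis i c k _ hx]
  simp

theorem extField_mem (μ : Lam M) : extField μ ∈ V M := by
  refine ⟨fun i c => ?_, fun i c k c' k' hk x hx => ?_, fun i c k hk x hx => ?_⟩
  · have : extField μ i c = ∑ k, extCoeff μ i c k • rtBasis (M.dir i) (M.simplex i c) k := by
      ext x
      simp [extField]
    rw [this]
    exact Submodule.sum_mem _ fun k _ => Submodule.smul_mem _ _ (rtBasis_mem _ _ _)
  · have hx' : x ∈ facet (M.simplex i c') k' := (M.interior_shared i c k c' k' hk).2 ▸ hx
    rw [normalTrace_extField μ i c k hx, normalTrace_extField μ i c' k' hx']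
    simp [extCoeff, hk, M.interior_symm i c k c' k' hk]
  · rw [normalTrace_extField μ i c k hx]
    simp [extCoeff, hk]

variable (M) in
/-- The discrete extension operator `R_h : Λ_h → V_h`. -/
def ext : Lam M →ₗ[ℝ] V M where
  toFun μ := ⟨extField μ, extField_mem μ⟩
  map_add' μ μ' := by
    have h : ∀ i c k, extCoeff (μ + μ') i c k = extCoeff μ i c k + extCoeff μ' i c k := by
      intro i c k
      unfold extCoeff
      cases M.kind i c k <;> simp [proj, add_mul, Finset.sum_add_distrib]
    refine Subtype.ext ?_
    funext i c x
    simp [extField, h, add_smul, Finset.sum_add_distrib]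
  map_smul' r μ := by
    have h : ∀ i c k, extCoeff (r • μ) i c k = r * extCoeff μ i c k := by
      intro i c k
      unfold extCoeff
      cases M.kind i c k <;> simp [proj, mul_assoc, Finset.mul_sum]
    refine Subtype.ext ?_
    funext i c x
    simp [extField, h, mul_smul, Finset.smul_sum]

variable (M) in
/-- The total flux `v_{0h} + R_h μ_h` of an element `[v_{0h}, μ_h]` of `W_h`. -/
def total : W M →ₗ[ℝ] V M :=
  (V0 M).subtype.coprod (ext M)

/-! ### Integrability -/

theorem isCompact_body {d : ℕ} (s : Affine.Simplex ℝ (E n) d) : IsCompact (body s) :=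
  (Set.finite_range _).isCompact_convexHull ℝ

theorem measure_lt_top_of_subset (A : AffineSubspace ℝ (E n)) {d : ℕ}
    (hd : Module.finrank ℝ A.direction = d) {S : Set (E n)} (hS : Bornology.IsBounded S)
    (hSA : S ⊆ (A : Set (E n))) : (μHE[d] : Measure (E n)) S < ⊤ := by
  rcases S.eq_empty_or_nonempty with rfl | ⟨p, hp⟩
  · simp
  let T : Set A.direction := (fun v : A.direction => (v : E n) + p) ⁻¹' S
  have hiso : Isometry (fun v : A.direction => (v : E n) + p) := by
    refine Isometry.of_dist_eq fun a b => ?_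
    simp [dist_eq_norm]
  have hT : (fun v : A.direction => (v : E n) + p) '' T = S := by
    refine Set.image_preimage_eq_of_subset fun x hx => ?_
    exact ⟨⟨x - p, AffineSubspace.vsub_mem_direction (hSA hx) (hSA hp)⟩, by simp⟩
  have hTb : Bornology.IsBounded T := by
    rw [← hT] at hS
    exact hiso.antilipschitz.isBounded_preimage hS |>.subset (Set.subset_preimage_image _ _)
  rw [← hT, hiso.euclideanHausdorffMeasure_image, ← hd]
  exact hTb.measure_lt_top

theorem measure_body_lt_top {d : ℕ} (s : Affine.Simplex ℝ (E n) d) :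
    (μHE[d] : Measure (E n)) (body s) < ⊤ := by
  refine measure_lt_top_of_subset (affineSpan ℝ (Set.range s.points)) ?_
    (isCompact_body s).isBounded (convexHull_subset_affineSpan _)
  rw [direction_affineSpan]
  exact s.independent.finrank_vectorSpan (by simp)

theorem integrableOn_body {d : ℕ} (s : Affine.Simplex ℝ (E n) d) {f : E n → ℝ}
    (hf : Continuous f) : IntegrableOn f (body s) μHE[d] := by
  obtain ⟨C, hC⟩ := (isCompact_body s).exists_bound_of_continuousOn hf.continuousOn
  refine IntegrableOn.of_bound (measure_body_lt_top s) hf.aestronglyMeasurable C ?_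
  exact (ae_restrict_iff' (isCompact_body s).measurableSet).2 (Filter.Eventually.of_forall hC)

theorem integrableOn_mortarFun {d : ℕ} (s : Affine.Simplex ℝ (E n) d) (μ : Lam M) (e : M.Iface) :
    IntegrableOn (mortarFun μ e) (body s) μHE[d] := by
  unfold mortarFun
  refine integrable_finsetSum _ fun m _ => ?_
  refine IntegrableOn.indicator ?_ (isCompact_body _).measurableSet
  exact integrableOn_body s continuous_const

theorem integrableOn_jump {d : ℕ} (s : Affine.Simplex ℝ (E n) d) (μ : Lam M) (i : M.Sub) :
    IntegrableOn (jump μ i) (body s) μHE[d] := by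
  unfold jump
  refine Integrable.neg (integrable_finsetSum _ fun e _ => ?_)
  split_ifs
  · exact integrableOn_mortarFun s μ e
  · exact integrable_zero _ _ _

/-- The projection is the `L²`-projection: `Π̂_h μ - μ` is orthogonal to the constants on every
facet on an interface. -/
theorem setIntegral_proj_sub (μ : Lam M) (e : M.Iface) (c : M.Cell (M.up e))
    (k : Fin (M.dim (M.up e) + 1)) :
    ∫ x in facet (M.simplex (M.up e) c) k, (proj μ e (facet (M.simplex (M.up e) c) k) -
      mortarFun μ e x) ∂μHE[M.dim (M.low e)] = 0 := by
  set f := facet (M.simplex (M.up e) c) k with hf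
  have hd : M.dim (M.up e) ≠ 0 := by rw [M.dim_up]; omega
  have : NeZero (M.dim (M.up e)) := ⟨hd⟩
  have hfc : IsCompact f :=
    ((Set.toFinite _).image _).isCompact_convexHull ℝ
  have hfin : (μHE[M.dim (M.low e)] : Measure (E n)) f < ⊤ := by
    refine measure_lt_top_of_subset
      (affineSpan ℝ (Set.range ((M.simplex (M.up e) c).faceOpposite k).points)) ?_
      hfc.isBounded ?_
    · rw [direction_affineSpan]
      refine ((M.simplex (M.up e) c).faceOpposite k).independent.finrank_vectorSpan ?_
      have := M.dim_up e
      simp only [Fintype.card_fin]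
      omega
    · rw [Affine.Simplex.range_faceOpposite_points]
      exact convexHull_subset_affineSpan _
  have hm : ∀ m, MeasurableSet (body (M.msimplex e m)) := fun m =>
    (isCompact_body _).measurableSet
  have hi : ∀ m, IntegrableOn ((body (M.msimplex e m)).indicator (fun _ => μ e m)) f
      μHE[M.dim (M.low e)] := fun m =>
    IntegrableOn.indicator (integrableOn_const hfin.ne) (hm m)
  have hsum : ∫ x in f, mortarFun μ e x ∂μHE[M.dim (M.low e)] =
      ∑ m, μ e m * (μHE[M.dim (M.low e)] : Measure (E n)).real (f ∩ body (M.msimplex e m)) := by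
    unfold mortarFun
    rw [integral_finsetSum _ fun m _ => hi m]
    refine Finset.sum_congr rfl fun m _ => ?_
    rw [setIntegral_indicator (hm m), setIntegral_const, smul_eq_mul, mul_comm]
  have h1 : IntegrableOn (fun _ : E n => proj μ e f) f μHE[M.dim (M.low e)] :=
    integrableOn_const hfin.ne
  have h2 : IntegrableOn (mortarFun μ e) f μHE[M.dim (M.low e)] :=
    integrable_finsetSum _ fun m _ => hi m
  rw [integral_sub h1 h2, hsum,
    setIntegral_const, smul_eq_mul, proj, Finset.mul_sum, ← Finset.sum_sub_distrib]
  refine Finset.sum_eq_zero fun m _ => ?_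
  by_cases h0 : (μHE[M.dim (M.low e)] : Measure (E n)).real f = 0
  · have : (μHE[M.dim (M.low e)] : Measure (E n)).real (f ∩ body (M.msimplex e m)) = 0 :=
      le_antisymm (h0 ▸ measureReal_mono Set.inter_subset_left hfin.ne) measureReal_nonneg
    rw [h0, this]
    simp
  · field_simp
    ring

/-! ### Bilinear forms -/

theorem rtPoly_contDiff {D : Submodule ℝ (E n)} {p : E n} {v : E n → D} (hv : v ∈ rtPoly D p) :
    ContDiff ℝ 1 v := by
  obtain ⟨a, b, h⟩ := hv
  rw [funext h]
  fun_prop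

theorem V_contDiff (v : V M) (i : M.Sub) (c : M.Cell i) : ContDiff ℝ 1 (v.1 i c) :=
  rtPoly_contDiff (v.2.1 i c)

theorem V_differentiable (v : V M) (i : M.Sub) (c : M.Cell i) : Differentiable ℝ (v.1 i c) :=
  (V_contDiff v i c).differentiable (by norm_num)

variable (P : Params M)

theorem integrableOn_inner (u v : V M) (i : M.Sub) (c : M.Cell i) :
    IntegrableOn (fun x => (inner ℝ ((P.K i).symm (u.1 i c x)) (v.1 i c x) : ℝ))
      (body (M.simplex i c)) μHE[M.dim i] := by
  refine integrableOn_body _ ?_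
  have h1 : Continuous fun x => (P.K i).symm (u.1 i c x) :=
    ((P.K i).symm.toLinearMap.continuous_of_finiteDimensional).comp (V_contDiff u i c).continuous
  exact h1.inner (V_contDiff v i c).continuous

/-- `(K⁻¹ u, v)_Ω`. -/
def massForm : V M →ₗ[ℝ] V M →ₗ[ℝ] ℝ :=
  LinearMap.mk₂ ℝ (fun u v => ∑ i, ∑ c, ∫ x in body (M.simplex i c),
      (inner ℝ ((P.K i).symm (u.1 i c x)) (v.1 i c x) : ℝ) ∂μHE[M.dim i])
    (fun u u' v => by
      simp only [← Finset.sum_add_distrib]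
      refine Finset.sum_congr rfl fun i _ => Finset.sum_congr rfl fun c _ => ?_
      rw [← integral_add (integrableOn_inner P u v i c) (integrableOn_inner P u' v i c)]
      simp only [Submodule.coe_add, Pi.add_apply, map_add, inner_add_left])
    (fun r u v => by
      simp only [smul_eq_mul, Finset.mul_sum, ← integral_const_mul]
      simp only [Submodule.coe_smul, Pi.smul_apply, map_smul]
      refine Finset.sum_congr rfl fun i _ => Finset.sum_congr rfl fun c _ => ?_
      congr 1
      funext x
      exact real_inner_smul_left (F := M.dir i) _ _ _)
    (fun u v v' => by
      simp only [← Finset.sum_add_distrib]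
      refine Finset.sum_congr rfl fun i _ => Finset.sum_congr rfl fun c _ => ?_
      rw [← integral_add (integrableOn_inner P u v i c) (integrableOn_inner P u v' i c)]
      simp only [Submodule.coe_add, Pi.add_apply, inner_add_right])
    (fun r u v => by
      simp only [smul_eq_mul, Finset.mul_sum, ← integral_const_mul]
      simp only [Submodule.coe_smul, Pi.smul_apply, real_inner_smul_right])

theorem normalTrace_add (u v : Field M) (i : M.Sub) (c : M.Cell i) (k : Fin (M.dim i + 1))
    (x : E n) : normalTrace (u + v) i c k x = normalTrace u i c k x + normalTrace v i c k x := by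
  simp only [normalTrace, Pi.add_apply, Submodule.coe_add, inner_add_left]

theorem normalTrace_smul (r : ℝ) (v : Field M) (i : M.Sub) (c : M.Cell i)
    (k : Fin (M.dim i + 1)) (x : E n) :
    normalTrace (r • v) i c k x = r * normalTrace v i c k x := by
  simp only [normalTrace, Pi.smul_apply, Submodule.coe_smul, real_inner_smul_left]

/-- `(K⁻¹ u, v)_{D,Ω}`: the sum over all cells and all their facets `f` of
`(u ⬝ ν_f) (v ⬝ ν_f) (K⁻¹ φ_f, φ_f)`, where `u ⬝ ν_f` and `v ⬝ ν_f` are constant on `f`. -/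
def diagMassForm : V M →ₗ[ℝ] V M →ₗ[ℝ] ℝ :=
  LinearMap.mk₂ ℝ (fun u v => ∑ i, ∑ c, ∑ k,
      normalTrace u.1 i c k (facetBarycenter (M.simplex i c) k) *
      normalTrace v.1 i c k (facetBarycenter (M.simplex i c) k) *
      ∫ x in body (M.simplex i c),
        (inner ℝ ((P.K i).symm (rtBasis (M.dir i) (M.simplex i c) k x))
          (rtBasis (M.dir i) (M.simplex i c) k x) : ℝ) ∂μHE[M.dim i])
    (fun u u' v => by
      simp only [Submodule.coe_add, normalTrace_add, add_mul, Finset.sum_add_distrib])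
    (fun r u v => by
      simp only [Submodule.coe_smul, normalTrace_smul, smul_eq_mul, Finset.mul_sum, mul_assoc])
    (fun u v v' => by
      simp only [Submodule.coe_add, normalTrace_add, mul_add, add_mul, Finset.sum_add_distrib])
    (fun r u v => by
      simp only [Submodule.coe_smul, normalTrace_smul, smul_eq_mul, Finset.mul_sum]
      refine Finset.sum_congr rfl fun i _ => Finset.sum_congr rfl fun c _ =>
        Finset.sum_congr rfl fun k _ => ?_
      ring)

/-- `(γ Kν⁻¹ λ, μ)_Γ`. -/
def mortarForm : Lam M →ₗ[ℝ] Lam M →ₗ[ℝ] ℝ :=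
  LinearMap.mk₂ ℝ (fun l μ => ∑ e, ∑ m, ∫ x in body (M.msimplex e m),
      P.γ e * (P.Kν e x)⁻¹ * l e m * μ e m ∂μHE[M.dim (M.low e)])
    (fun u u' v => by
      simp only [integral_mul_const, Pi.add_apply, ← Finset.sum_add_distrib]
      refine Finset.sum_congr rfl fun i _ => Finset.sum_congr rfl fun c _ => ?_
      ring)
    (fun r u v => by
      simp only [integral_mul_const, Pi.smul_apply, smul_eq_mul, Finset.mul_sum]
      refine Finset.sum_congr rfl fun i _ => Finset.sum_congr rfl fun c _ => ?_
      ring)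
    (fun u v v' => by
      simp only [integral_mul_const, Pi.add_apply, ← Finset.sum_add_distrib]
      refine Finset.sum_congr rfl fun i _ => Finset.sum_congr rfl fun c _ => ?_
      ring)
    (fun r u v => by
      simp only [integral_mul_const, Pi.smul_apply, smul_eq_mul, Finset.mul_sum]
      refine Finset.sum_congr rfl fun i _ => Finset.sum_congr rfl fun c _ => ?_
      ring)

/-- `a([v_{0h}, μ_h], …)`. -/
def aForm : W M →ₗ[ℝ] W M →ₗ[ℝ] ℝ :=
  (massForm P).compl₁₂ (total M) (total M) +
    (mortarForm P).compl₁₂ (LinearMap.snd ℝ _ _) (LinearMap.snd ℝ _ _)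

/-- `a^D`. -/
def aDForm : W M →ₗ[ℝ] W M →ₗ[ℝ] ℝ :=
  (diagMassForm P).compl₁₂ (total M) (total M) +
    (mortarForm P).compl₁₂ (LinearMap.snd ℝ _ _) (LinearMap.snd ℝ _ _)

/-- The mixed-dimensional divergence `D ⬝ [v_{0h} + R_h μ_h, μ_h] = ∇ ⬝ (v_{0h} + R_h μ_h) + ⟦μ_h⟧`
on the cell `c` of the subdomain `i`. -/
def mixedDiv (r : W M) (i : M.Sub) (c : M.Cell i) (x : E n) : ℝ :=
  tangentialDiv ((total M r).1 i c) x + jump r.2 i x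

theorem tangentialDiv_add {D : Submodule ℝ (E n)} {u v : E n → D} (hu : Differentiable ℝ u)
    (hv : Differentiable ℝ v) (x : E n) :
    tangentialDiv (u + v) x = tangentialDiv u x + tangentialDiv v x := by
  simp only [tangentialDiv]
  rw [fderiv_add (hu x) (hv x), ← map_add]
  rfl

theorem tangentialDiv_smul {D : Submodule ℝ (E n)} {v : E n → D} (r : ℝ)
    (hv : Differentiable ℝ v) (x : E n) :
    tangentialDiv (r • v) x = r * tangentialDiv v x := by
  simp only [tangentialDiv]
  rw [fderiv_const_smul (hv x), ← smul_eq_mul, ← map_smul]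
  rfl

theorem jump_add (l μ : Lam M) (i : M.Sub) (x : E n) :
    jump (l + μ) i x = jump l i x + jump μ i x := by
  have h : ∀ e, mortarFun (l + μ) e x = mortarFun l e x + mortarFun μ e x := by
    intro e
    simp only [mortarFun, ← Finset.sum_add_distrib, Pi.add_apply]
    refine Finset.sum_congr rfl fun m _ => ?_
    by_cases hx : x ∈ body (M.msimplex e m) <;> simp [hx]
  simp only [jump, h, ← neg_add, ← Finset.sum_add_distrib]
  congr 1
  refine Finset.sum_congr rfl fun m _ => ?_
  split_ifs <;> simp

theorem jump_smul (r : ℝ) (μ : Lam M) (i : M.Sub) (x : E n) :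
    jump (r • μ) i x = r * jump μ i x := by
  have h : ∀ e, mortarFun (r • μ) e x = r * mortarFun μ e x := by
    intro e
    simp only [mortarFun, Finset.mul_sum, Pi.smul_apply]
    refine Finset.sum_congr rfl fun m _ => ?_
    by_cases hx : x ∈ body (M.msimplex e m) <;> simp [hx]
  simp only [jump, h, mul_neg, Finset.mul_sum]
  congr 1
  refine Finset.sum_congr rfl fun m _ => ?_
  split_ifs <;> simp

theorem mixedDiv_add (r s : W M) (i : M.Sub) (c : M.Cell i) (x : E n) :
    mixedDiv (r + s) i c x = mixedDiv r i c x + mixedDiv s i c x := by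
  have h := tangentialDiv_add (V_differentiable (total M r) i c)
    (V_differentiable (total M s) i c) x
  simp only [mixedDiv, map_add, Submodule.coe_add, Pi.add_apply, Prod.snd_add, jump_add, h]
  ring

theorem mixedDiv_smul (t : ℝ) (r : W M) (i : M.Sub) (c : M.Cell i) (x : E n) :
    mixedDiv (t • r) i c x = t * mixedDiv r i c x := by
  have h := tangentialDiv_smul t (V_differentiable (total M r) i c) x
  have h2 : jump (t • r).2 i x = t * jump r.2 i x := jump_smul t r.2 i x
  simp only [mixedDiv, map_smul, Submodule.coe_smul, Pi.smul_apply, h, h2]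
  ring

theorem integrableOn_mixedDiv (r : W M) (i : M.Sub) (c : M.Cell i) :
    IntegrableOn (mixedDiv r i c) (body (M.simplex i c)) μHE[M.dim i] := by
  refine Integrable.add (integrableOn_body _ ?_) (integrableOn_jump _ _ _)
  have h1 : Continuous (fderiv ℝ ((total M r).1 i c)) :=
    (V_contDiff (total M r) i c).continuous_fderiv (by norm_num)
  let L : (E n →L[ℝ] M.dir i) →ₗ[ℝ] ℝ :=
    { toFun := fun T => LinearMap.trace ℝ (M.dir i) (T.toLinearMap ∘ₗ (M.dir i).subtype)
      map_add' := fun S T => by rw [← map_add]; rfl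
      map_smul' := fun t T => by rw [RingHom.id_apply, ← map_smul]; rfl }
  exact L.continuous_of_finiteDimensional.comp h1

variable (M) in
/-- `b([v_{0h}, μ_h], p_h) = -(p_h, D ⬝ [v_{0h} + R_h μ_h, μ_h])_Ω`. -/
def bForm : W M →ₗ[ℝ] Q M →ₗ[ℝ] ℝ :=
  LinearMap.mk₂ ℝ (fun r p => -∑ i, ∑ c, ∫ x in body (M.simplex i c),
      p i c * mixedDiv r i c x ∂μHE[M.dim i])
    (fun r s p => by
      simp only [integral_const_mul, ← neg_add, ← Finset.sum_add_distrib]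
      congr 1
      refine Finset.sum_congr rfl fun i _ => Finset.sum_congr rfl fun c _ => ?_
      rw [← mul_add, ← integral_add (integrableOn_mixedDiv r i c) (integrableOn_mixedDiv s i c)]
      simp only [mixedDiv_add])
    (fun t r p => by
      simp only [integral_const_mul, mixedDiv_smul, smul_eq_mul, mul_neg, Finset.mul_sum]
      congr 1
      refine Finset.sum_congr rfl fun i _ => Finset.sum_congr rfl fun c _ => ?_
      ring)
    (fun r p q => by
      simp only [integral_const_mul, Pi.add_apply, ← neg_add, ← Finset.sum_add_distrib]
      congr 1
      refine Finset.sum_congr rfl fun i _ => Finset.sum_congr rfl fun c _ => ?_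
      ring)
    (fun t r p => by
      simp only [integral_const_mul, Pi.smul_apply, smul_eq_mul, mul_neg, Finset.mul_sum, mul_assoc])

end Spaces

/-! ### Operators, preconditioner, condition number -/

section Operators

/-- The inverse of a bijective linear map (`0` for all other linear maps). -/
def inv {U U' : Type} [AddCommMonoid U] [Module ℝ U] [AddCommMonoid U'] [Module ℝ U']
    (T : U →ₗ[ℝ] U') : U' →ₗ[ℝ] U :=
  open Classical in
  if h : Function.Bijective T then (LinearEquiv.ofBijective T h).symm.toLinearMap else 0

/-- The operator norm of a linear map with respect to a norm `N`. -/
def opNorm {U : Type} [AddCommMonoid U] [Module ℝ U] (N : U → ℝ) (T : U →ₗ[ℝ] U) : ENNReal :=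
  ⨆ x : U, ENNReal.ofReal (N (T x)) / ENNReal.ofReal (N x)

/-- The condition number `κ(T) = ‖T‖ ‖T⁻¹‖` of a bijective linear map with respect to a
norm `N`. -/
def condNumber {U : Type} [AddCommMonoid U] [Module ℝ U] (N : U → ℝ) (T : U →ₗ[ℝ] U) : ENNReal :=
  opNorm N T * opNorm N (inv T)

variable {n : ℕ} {M : MixedDimMesh n} (P : Params M)

/-- `A : W_h → W_h'`. -/
def opA : W M →ₗ[ℝ] Module.Dual ℝ (W M) := aForm P

/-- `D_A : W_h → W_h'`. -/
def opDA : W M →ₗ[ℝ] Module.Dual ℝ (W M) := aDForm P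

variable (M) in
/-- `B : W_h → Q_h'`. -/
def opB : W M →ₗ[ℝ] Module.Dual ℝ (Q M) := bForm M

variable (M) in
/-- `Bᵀ : Q_h → W_h'`. -/
def opBT : Q M →ₗ[ℝ] Module.Dual ℝ (W M) := (bForm M).flip

/-- The discrete gradient `D_h : Q_h → W_h`, given by `a^D(D_h p, r) = b(r, p)` for all `r`. -/
def discGrad : Q M →ₗ[ℝ] W M := inv (opDA P) ∘ₗ opBT M

/-- `B D_A⁻¹ Bᵀ : Q_h → Q_h'`. -/
def opS : Q M →ₗ[ℝ] Module.Dual ℝ (Q M) := opB M ∘ₗ inv (opDA P) ∘ₗ opBT M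

/-- The operator `𝒜 = (A, Bᵀ; -B, 0) : X → X'` of the discrete system, where `X' = W_h' × Q_h'`. -/
def sysOp : X M →ₗ[ℝ] Module.Dual ℝ (W M) × Module.Dual ℝ (Q M) :=
  ((opA P).coprod (opBT M)).prod ((-opB M).coprod 0)

/-- The block diagonal preconditioner `ℬ_D = diag(A, B D_A⁻¹ Bᵀ)⁻¹ : X' → X`. -/
def precond : Module.Dual ℝ (W M) × Module.Dual ℝ (Q M) →ₗ[ℝ] X M :=
  inv ((opA P).prodMap (opS P))

/-- The weighted norm `|||(r, q)|||² = a(r, r) + a^D(D_h q, D_h q)`. -/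
def triNorm (x : X M) : ℝ :=
  Real.sqrt (aForm P x.1 x.1 + aDForm P (discGrad P x.2) (discGrad P x.2))

/-- `ℒ(w, p; r, q) = a(w, r) + a^D(D_h p, r) + a^D(D_h q, w)`. -/
def compForm (x y : X M) : ℝ :=
  aForm P x.1 y.1 + aDForm P (discGrad P x.2) y.1 + aDForm P (discGrad P y.2) x.1

/-- The continuity condition for `ℒ` with constant `α`. -/
def Continuity (α : ℝ) : Prop :=
  ∀ x y : X M, |compForm P x y| ≤ α * triNorm P x * triNorm P y

/-- The inf-sup condition for `ℒ` with constant `β`. -/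
def InfSup (β : ℝ) : Prop :=
  (β : EReal) ≤ ⨅ (y : X M) (_ : y ≠ 0), ⨆ (x : X M) (_ : x ≠ 0),
    ((compForm P x y / (triNorm P x * triNorm P y) : ℝ) : EReal)

end Operators

end

end MixedDim

namespace MixedDim

/-! ### Measures of cones, convex sets and simplices -/

/-! The theorem separates into an abstract saddle point argument and two facts about the
discretization.

Abstract part (`IsSaddle`). Let `a`, `d` be symmetric positive definite, let `b` be nondegenerate in
its second argument, and let the gradient be given by `d (D p) r = b r p`. In the inner product of
the weighted norm, the preconditioned operator `T` is the Riesz representative of the composite form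
`L`, up to the isometry `(r, q) ↦ (r, -q)` (`inner_precond`). Continuity of `L` therefore bounds `T`
by `α`, the inf-sup condition bounds `T⁻¹` by `1 / β`, and `κ(T) ≤ α / β` follows for every
admissible pair (`condNumber_le`). If `a ≤ 4 d ≤ 4 C a`, Cauchy–Schwarz gives `α = 1 + 2 √C`
(`abs_comp_le`), and testing `(r, q)` with `(r + D q / 4, -q)` gives `β = 1 / 16` (`infSup`).

First fact: `a` and `a^D` are equivalent with constants that depend only on `σ` and `τ`. On a cell
of dimension at most 3 a field is a sum of at most four basis contributions, so `a ≤ 4 a^D`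
(`massForm_self_le`). Conversely, the fluxes of a field are controlled by its mean square because
the field is affine (`inner_sq_le`), and a basis function is at most `diam / height ≤ σ`. Volumes
and the size of `K` cancel, and only the anisotropy ratio remains (`diagMassForm_self_le`). The
mortar term is the same in both forms, so `Kν`, `γ` and the interface meshes do not enter.

Second fact: a pressure orthogonal to all mixed-dimensional divergences is zero
(`eq_zero_of_bForm`). A unit flux through an interior facet shows that neighbouring cells have equal
pressures, so the pressure is constant on each connected subdomain. The characteristic function of
an interface carries the constant to the adjacent subdomain, and a Dirichlet facet makes it zero.
This needs `∫ div = ∑ flux · area` on a cell, hence the cone formula for the volume of a simplex,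
and it needs that facets and mortar cells each cover the lower-dimensional subdomain once up to null
sets. -/

theorem lintegral_Ioc_pow (m : ℕ) :
    ∫⁻ x in Set.Ioc (0 : ℝ) 1, ENNReal.ofReal (x ^ m) = ((m : ENNReal) + 1)⁻¹ := by
  rw [← ofReal_integral_eq_lintegral_ofReal]
  · rw [← intervalIntegral.integral_of_le zero_le_one, integral_pow]
    simp only [one_pow, ne_eq, Nat.add_eq_zero_iff, one_ne_zero, and_false, not_false_eq_true,
      zero_pow, sub_zero, one_div]
    rw [ENNReal.ofReal_inv_of_pos (by positivity), ENNReal.ofReal_add (by positivity) zero_le_one]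
    simp
  · exact ((continuous_pow m).integrableOn_Icc).mono_set Set.Ioc_subset_Icc_self
  · filter_upwards [ae_restrict_mem measurableSet_Ioc] with x hx
    exact pow_nonneg hx.1.le m

open scoped Pointwise in
/-- The volume of the cone with apex `0` over a base in the plane with foot `v`. -/
theorem measure_cone {V : Type*} [NormedAddCommGroup V] [InnerProductSpace ℝ V]
    [FiniteDimensional ℝ V] [MeasurableSpace V] [BorelSpace V] {v : V} (hv : v ≠ 0) {f : Set V}
    (hf : IsCompact f) (hfv : ∀ y ∈ f, inner ℝ y v = ‖v‖ ^ 2) :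
    (Module.finrank ℝ V : ENNReal) * (μHE[Module.finrank ℝ V] : Measure V)
      ((fun q : ℝ × V => q.1 • q.2) '' (Set.Icc 0 1 ×ˢ f)) =
      ‖v‖ₑ * (μHE[Module.finrank ℝ V - 1] : Measure V) f := by
  have hv2 : 0 < ‖v‖ ^ 2 := by positivity
  set t := (fun q : ℝ × V => q.1 • q.2) '' (Set.Icc 0 1 ×ˢ f) with ht
  have htm : MeasurableSet t :=
    ((isCompact_Icc.prod hf).image (by fun_prop)).measurableSet
  have hd : 0 < Module.finrank ℝ V := Module.finrank_pos_iff_exists_ne_zero.2 ⟨v, hv⟩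
  obtain ⟨m, hm⟩ : ∃ m, Module.finrank ℝ V = m + 1 := ⟨_, (Nat.succ_pred_eq_of_pos hd).symm⟩
  -- Fubini along `v`: for `0 < x ≤ 1` the slice at `x • v` is `x • f`, of measure `x ^ m` times
  -- that of `f`; for all other `x ≠ 0` it is empty. The slice through the apex belongs to a single
  -- parameter and is discarded.
  rw [EuclideanGeometry.euclideanHausdorffMeasure_eq_lintegral (0 : V) hv htm]
  have hmem : ∀ (x : ℝ) (z : V), z ∈ AffineSubspace.mk' (x • v +ᵥ (0 : V)) (ℝ ∙ v)ᗮ ↔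
      inner ℝ z v = x * ‖v‖ ^ 2 := by
    intro x z
    rw [AffineSubspace.mem_mk', Submodule.mem_orthogonal_singleton_iff_inner_left]
    simp only [vadd_eq_add, add_zero, vsub_eq_sub, inner_sub_left, real_inner_smul_left,
      real_inner_self_eq_norm_sq, sub_eq_zero]
  have hs : ∀ᵐ x : ℝ, (μHE[Module.finrank ℝ V - 1] : Measure V)
      (t ∩ AffineSubspace.mk' (x • v +ᵥ (0 : V)) (ℝ ∙ v)ᗮ) =
      (Set.Ioc (0 : ℝ) 1).indicator (fun x => ENNReal.ofReal (x ^ m) *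
        (μHE[Module.finrank ℝ V - 1] : Measure V) f) x := by
    have h0 : ∀ᵐ x : ℝ, x ≠ 0 := by simp [ae_iff]
    filter_upwards [h0] with x hx0
    by_cases hx : x ∈ Set.Ioc (0 : ℝ) 1
    · have e : t ∩ AffineSubspace.mk' (x • v +ᵥ (0 : V)) (ℝ ∙ v)ᗮ = x • f := by
        ext z
        simp only [Set.mem_inter_iff, SetLike.mem_coe, hmem, ht, Set.mem_image, Set.mem_prod,
          Prod.exists, Set.mem_smul_set]
        constructor
        · rintro ⟨⟨a, y, ⟨_, hy⟩, rfl⟩, h⟩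
          rw [real_inner_smul_left, hfv y hy] at h
          exact ⟨y, hy, by rw [mul_right_cancel₀ hv2.ne' h]⟩
        · rintro ⟨y, hy, rfl⟩
          exact ⟨⟨x, y, ⟨⟨hx.1.le, hx.2⟩, hy⟩, rfl⟩, by rw [real_inner_smul_left, hfv y hy]⟩
      rw [e, Measure.euclideanHausdorffMeasure_smul₀ _ hx.1.ne', Set.indicator_of_mem hx, hm,
        Nat.add_sub_cancel, ENNReal.smul_def, smul_eq_mul]
      congr 1
      rw [← Real.norm_of_nonneg hx.1.le, ENNReal.ofReal_pow (norm_nonneg _), ofReal_norm]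
      simp [enorm]
    · have e : t ∩ AffineSubspace.mk' (x • v +ᵥ (0 : V)) (ℝ ∙ v)ᗮ = ∅ := by
        ext z
        simp only [Set.mem_inter_iff, SetLike.mem_coe, hmem, ht, Set.mem_image, Set.mem_prod,
          Prod.exists, Set.mem_empty_iff_false, iff_false]
        rintro ⟨⟨a, y, ⟨ha, hy⟩, rfl⟩, h⟩
        rw [real_inner_smul_left, hfv y hy] at h
        rw [mul_right_cancel₀ hv2.ne' h] at ha
        exact hx ⟨lt_of_le_of_ne ha.1 hx0.symm, ha.2⟩
      rw [e, measure_empty, Set.indicator_of_notMem hx]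
  rw [lintegral_congr_ae hs, lintegral_indicator measurableSet_Ioc,
    lintegral_mul_const _ (by fun_prop), lintegral_Ioc_pow, hm]
  have h1 : ((m + 1 : ℕ) : ENNReal) * ((m : ENNReal) + 1)⁻¹ = 1 := by
    push_cast
    exact ENNReal.mul_inv_cancel (by simp) (by simp)
  calc _ = (((m + 1 : ℕ) : ENNReal) * ((m : ENNReal) + 1)⁻¹) *
      (‖v‖ₑ * (μHE[m + 1 - 1] : Measure V) f) := by ring
    _ = _ := by rw [h1, one_mul]

/-- The relative boundary of a convex set is a null set. -/
theorem measure_intrinsicFrontier {n d : ℕ} {C : Set (E n)} (hC : Convex ℝ C)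
    (hd : Module.finrank ℝ (vectorSpan ℝ C) = d) :
    (μHE[d] : Measure (E n)) (intrinsicFrontier ℝ C) = 0 := by
  rcases C.eq_empty_or_nonempty with rfl | ⟨p, hp⟩
  · simp
  let p' : affineSpan ℝ C := ⟨p, subset_affineSpan ℝ C hp⟩
  have : Nonempty (affineSpan ℝ C) := ⟨p'⟩
  -- This isometry moves the claim to the direction space, where the Hausdorff measure is a Haar
  -- measure and frontiers of convex sets are null.
  let e : (affineSpan ℝ C).direction ≃ᵢ affineSpan ℝ C := IsometryEquiv.vaddConst p'
  have hd' : Module.finrank ℝ (affineSpan ℝ C).direction = d := by rw [direction_affineSpan, hd]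
  have h1 : frontier ((↑) ⁻¹' C : Set (affineSpan ℝ C)) =
      e '' frontier (e ⁻¹' ((↑) ⁻¹' C)) := by
    have := e.toHomeomorph.preimage_frontier ((↑) ⁻¹' C : Set (affineSpan ℝ C))
    have h2 : e ⁻¹' frontier ((↑) ⁻¹' C : Set (affineSpan ℝ C)) =
      frontier (e ⁻¹' ((↑) ⁻¹' C)) := this
    rw [← h2, Set.image_preimage_eq _ e.surjective]
  have hconv : Convex ℝ (e ⁻¹' ((↑) ⁻¹' C)) := by
    have : e ⁻¹' ((↑) ⁻¹' C) = (fun v : (affineSpan ℝ C).direction => (v : E n)) ⁻¹'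
        ((fun x => x + p) ⁻¹' C) := by
      ext v
      simp [e, p']
    rw [this]
    exact (hC.translate_preimage_left p).linear_preimage (affineSpan ℝ C).direction.subtype
  rw [intrinsicFrontier, isometry_subtype_coe.euclideanHausdorffMeasure_image, h1,
    e.isometry.euclideanHausdorffMeasure_image, ← hd']
  exact hconv.addHaar_frontier _

/-- A common point cannot be in both relative interiors, so it lies on one of the two relative
boundaries. This turns the disjointness conditions on meshes into additivity of measure. -/
theorem measure_inter_eq_zero {n d : ℕ} {C C' : Set (E n)} (hC : Convex ℝ C) (hC' : Convex ℝ C')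
    (hd : Module.finrank ℝ (vectorSpan ℝ C) = d) (hd' : Module.finrank ℝ (vectorSpan ℝ C') = d)
    (h : Disjoint (intrinsicInterior ℝ C) (intrinsicInterior ℝ C')) :
    (μHE[d] : Measure (E n)) (C ∩ C') = 0 := by
  refine measure_mono_null (t := intrinsicFrontier ℝ C ∪ intrinsicFrontier ℝ C') ?_
    (measure_union_null (measure_intrinsicFrontier hC hd) (measure_intrinsicFrontier hC' hd'))
  rintro x ⟨hx, hx'⟩
  have h1 := subset_intrinsicClosure (𝕜 := ℝ) hx
  have h2 := subset_intrinsicClosure (𝕜 := ℝ) hx'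
  rw [← intrinsicInterior_union_intrinsicFrontier] at h1 h2
  rcases h1 with h1 | h1
  · rcases h2 with h2 | h2
    · exact (Set.disjoint_left.1 h h1 h2).elim
    · exact Or.inr h2
  · exact Or.inl h1

/-- A nonempty convex set has a nonempty relative interior, which is open in its affine span. -/
theorem measure_pos_of_convex {n d : ℕ} {C : Set (E n)} (hC : Convex ℝ C) (hne : C.Nonempty)
    (hd : Module.finrank ℝ (vectorSpan ℝ C) = d) : 0 < (μHE[d] : Measure (E n)) C := by
  obtain ⟨p, hp⟩ := hne
  let p' : affineSpan ℝ C := ⟨p, subset_affineSpan ℝ C hp⟩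
  have : Nonempty (affineSpan ℝ C) := ⟨p'⟩
  let e : (affineSpan ℝ C).direction ≃ᵢ affineSpan ℝ C := IsometryEquiv.vaddConst p'
  have hd' : Module.finrank ℝ (affineSpan ℝ C).direction = d := by rw [direction_affineSpan, hd]
  refine lt_of_lt_of_le ?_ (measure_mono (intrinsicInterior_subset (𝕜 := ℝ)))
  rw [intrinsicInterior, isometry_subtype_coe.euclideanHausdorffMeasure_image]
  have h0 : (interior ((↑) ⁻¹' C : Set (affineSpan ℝ C))).Nonempty := by
    have : (intrinsicInterior ℝ C).Nonempty := Set.Nonempty.intrinsicInterior hC ⟨p, hp⟩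
    rwa [intrinsicInterior, Set.image_nonempty] at this
  rw [← Set.image_preimage_eq (interior ((↑) ⁻¹' C : Set (affineSpan ℝ C))) e.surjective,
    e.isometry.euclideanHausdorffMeasure_image, ← hd']
  exact (isOpen_interior.preimage e.continuous).measure_pos _ (h0.preimage e.surjective)

/-! ### Heights, facets and volume of a simplex. -/

section Simplex

variable {n d : ℕ} (s : Affine.Simplex ℝ (E n) d)

theorem convex_body : Convex ℝ (body s) := convex_convexHull _ _

theorem vectorSpan_convexHull (S : Set (E n)) : vectorSpan ℝ (convexHull ℝ S) = vectorSpan ℝ S := by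
  rw [← direction_affineSpan, ← direction_affineSpan, affineSpan_convexHull]

theorem finrank_vectorSpan_body : Module.finrank ℝ (vectorSpan ℝ (body s)) = d := by
  rw [body, vectorSpan_convexHull]
  exact s.independent.finrank_vectorSpan (by simp)

theorem points_mem_body (k : Fin (d + 1)) : s.points k ∈ body s :=
  subset_convexHull ℝ _ (Set.mem_range_self k)

theorem points_mem_facet {j k : Fin (d + 1)} (h : j ≠ k) : s.points j ∈ facet s k :=
  subset_convexHull ℝ _ (Set.mem_image_of_mem _ h)

theorem measure_body_pos : 0 < (μHE[d] : Measure (E n)) (body s) :=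
  measure_pos_of_convex (convex_body s) ⟨_, points_mem_body s 0⟩ (finrank_vectorSpan_body s)

theorem measureReal_body_pos : 0 < (μHE[d] : Measure (E n)).real (body s) :=
  ENNReal.toReal_pos (measure_body_pos s).ne' (measure_body_lt_top s).ne

theorem measure_body_inter (t : Affine.Simplex ℝ (E n) d)
    (h : Disjoint (intrinsicInterior ℝ (body s)) (intrinsicInterior ℝ (body t))) :
    (μHE[d] : Measure (E n)) (body s ∩ body t) = 0 :=
  measure_inter_eq_zero (convex_body s) (convex_body t) (finrank_vectorSpan_body s)
    (finrank_vectorSpan_body t) h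

theorem facet_eq_body [NeZero d] (k : Fin (d + 1)) : facet s k = body (s.faceOpposite k) := by
  rw [facet, body, Affine.Simplex.range_faceOpposite_points]

theorem isCompact_facet (k : Fin (d + 1)) : IsCompact (facet s k) :=
  ((Set.toFinite _).image _).isCompact_convexHull ℝ

theorem convex_facet (k : Fin (d + 1)) : Convex ℝ (facet s k) := convex_convexHull _ _

theorem facet_nonempty [NeZero d] (k : Fin (d + 1)) : (facet s k).Nonempty := by
  rw [facet_eq_body]
  exact ⟨_, points_mem_body _ 0⟩

theorem facetHeight_eq [NeZero d] (k : Fin (d + 1)) : facetHeight s k = s.height k := by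
  simp [facetHeight, NeZero.ne d]

theorem facetHeight_pos [NeZero d] (k : Fin (d + 1)) : 0 < facetHeight s k := by
  rw [facetHeight_eq]
  exact s.height_pos k

theorem norm_outwardNormal [NeZero d] (k : Fin (d + 1)) : ‖outwardNormal s k‖ = 1 := by
  have h := s.height_pos k
  rw [outwardNormal, dif_neg (NeZero.ne d), norm_smul, ← dist_eq_norm, dist_comm]
  change ‖(s.height k)⁻¹‖ * s.height k = 1
  rw [Real.norm_of_nonneg (by positivity), inv_mul_cancel₀ h.ne']

theorem outwardNormal_mem [NeZero d] (k : Fin (d + 1)) :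
    outwardNormal s k ∈ vectorSpan ℝ (Set.range s.points) := by
  rw [outwardNormal, dif_neg (NeZero.ne d), ← direction_affineSpan]
  exact Submodule.smul_mem _ _ (AffineSubspace.vsub_mem_direction
    (Affine.Simplex.altitudeFoot_mem_affineSpan _ _) (mem_affineSpan ℝ (Set.mem_range_self _)))

theorem finrank_vectorSpan_facet [NeZero d] (k : Fin (d + 1)) :
    Module.finrank ℝ (vectorSpan ℝ (facet s k)) = d - 1 := by
  rw [facet_eq_body, finrank_vectorSpan_body]

theorem measure_facet_pos [NeZero d] (k : Fin (d + 1)) :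
    0 < (μHE[d - 1] : Measure (E n)) (facet s k) := by
  rw [facet_eq_body]
  exact measure_body_pos _

theorem measure_facet_lt_top [NeZero d] (k : Fin (d + 1)) :
    (μHE[d - 1] : Measure (E n)) (facet s k) < ⊤ := by
  rw [facet_eq_body]
  exact measure_body_lt_top _

/-- A simplex is the cone over a facet. -/
theorem mem_body_iff [NeZero d] (k : Fin (d + 1)) (x : E n) :
    x ∈ body s ↔ ∃ a ∈ Set.Icc (0 : ℝ) 1, ∃ y ∈ facet s k,
      x = s.points k + a • (y - s.points k) := by
  have h1 : Set.range s.points = insert (s.points k) (s.points '' {k}ᶜ) := by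
    rw [← Set.image_insert_eq, ← Set.image_univ]
    congr 1
    ext j
    by_cases h : j = k <;> simp [h]
  have hne : (s.points '' {k}ᶜ).Nonempty := by
    have := facet_nonempty s k
    rwa [facet, convexHull_nonempty_iff] at this
  rw [body, h1, convexHull_insert hne, mem_convexJoin]
  constructor
  · rintro ⟨z, hz, y, hy, hx⟩
    rw [Set.mem_singleton_iff] at hz
    subst hz
    rw [segment_eq_image'] at hx
    obtain ⟨a, ha, rfl⟩ := hx
    exact ⟨a, ha, y, hy, rfl⟩
  · rintro ⟨a, ha, y, hy, rfl⟩
    refine ⟨_, rfl, y, hy, ?_⟩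
    rw [segment_eq_image']
    exact ⟨a, ha, rfl⟩

/-- The volume of a simplex. -/
theorem measure_body_eq [NeZero d] (k : Fin (d + 1)) :
    (d : ENNReal) * (μHE[d] : Measure (E n)) (body s) =
      ENNReal.ofReal (facetHeight s k) * (μHE[d - 1] : Measure (E n)) (facet s k) := by
  set D := vectorSpan ℝ (Set.range s.points) with hD
  have hDd : Module.finrank ℝ D = d := s.independent.finrank_vectorSpan (by simp)
  let g : D → E n := fun v => (v : E n) + s.points k
  have hg : Isometry g := Isometry.of_dist_eq fun a b => by simp [g, dist_eq_norm]
  have hsub : ∀ x ∈ body s, x - s.points k ∈ D := by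
    intro x hx
    rw [hD, ← direction_affineSpan]
    exact AffineSubspace.vsub_mem_direction (convexHull_subset_affineSpan _ hx)
      (mem_affineSpan ℝ (Set.mem_range_self _))
  let f : Set D := g ⁻¹' facet s k
  have hgf : g '' f = facet s k := by
    refine Set.image_preimage_eq_of_subset fun x hx => ?_
    exact ⟨⟨x - s.points k, hsub x (facet_subset_body s k hx)⟩, by simp [g]⟩
  have hfc : IsCompact f :=
    hg.isClosedEmbedding.isCompact_preimage (isCompact_facet s k)
  have hgb : g '' ((fun q : ℝ × D => q.1 • q.2) '' (Set.Icc 0 1 ×ˢ f)) = body s := by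
    ext x
    rw [mem_body_iff s k]
    constructor
    · rintro ⟨_, ⟨⟨a, y⟩, ⟨ha, hy⟩, rfl⟩, rfl⟩
      exact ⟨a, ha, g y, hy, by simp [g, add_comm]⟩
    · rintro ⟨a, ha, y, hy, rfl⟩
      rw [← hgf] at hy
      obtain ⟨y, hy, rfl⟩ := hy
      exact ⟨_, ⟨⟨a, y⟩, ⟨ha, hy⟩, rfl⟩, by simp [g, add_comm]⟩
  have hh := facetHeight_pos s k
  -- The vector from the vertex `k` to the foot of its altitude; with the vertex as origin, the
  -- facet lies in the plane with foot `v`.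
  let v : D := facetHeight s k • ⟨outwardNormal s k, outwardNormal_mem s k⟩
  have hvn : ‖v‖ = facetHeight s k := by
    rw [norm_smul, Submodule.coe_norm, norm_outwardNormal, mul_one, Real.norm_of_nonneg hh.le]
  have hv : v ≠ 0 := norm_ne_zero_iff.1 (hvn ▸ hh.ne')
  have key := measure_cone hv hfc fun y hy => by
    have h := inner_sub_outwardNormal s k k hy
    simp only [g, add_sub_cancel_right, if_true] at h
    rw [hvn, Submodule.coe_inner]
    simp only [v, Submodule.coe_smul, real_inner_smul_right, h]
    ring
  rw [← hg.euclideanHausdorffMeasure_image, ← hg.euclideanHausdorffMeasure_image (s := f),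
    hgf, hgb, hDd, ← ofReal_norm, hvn] at key
  exact key

theorem measureReal_body_eq [NeZero d] (k : Fin (d + 1)) :
    (d : ℝ) * (μHE[d] : Measure (E n)).real (body s) =
      facetHeight s k * (μHE[d - 1] : Measure (E n)).real (facet s k) := by
  have h := congrArg ENNReal.toReal (measure_body_eq s k)
  rwa [ENNReal.toReal_mul, ENNReal.toReal_mul, ENNReal.toReal_natCast,
    ENNReal.toReal_ofReal (facetHeight_pos s k).le] at h

/-- Gauss's theorem for one basis function: its divergence is `d / height`, and its flux is the area
of its facet. -/
theorem measureReal_facet_eq [NeZero d] (k : Fin (d + 1)) :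
    (facetHeight s k)⁻¹ * d * (μHE[d] : Measure (E n)).real (body s) =
      (μHE[d - 1] : Measure (E n)).real (facet s k) := by
  have h := facetHeight_pos s k
  rw [mul_assoc, measureReal_body_eq s k, ← mul_assoc, inv_mul_cancel₀ h.ne', one_mul]

/-- A simplex lies between the plane of a facet and the parallel plane through the opposite
vertex. -/
theorem inner_sub_outwardNormal_mem_Icc [NeZero d] (k : Fin (d + 1)) {x : E n} (hx : x ∈ body s) :
    inner ℝ (x - s.points k) (outwardNormal s k) ∈ Set.Icc 0 (facetHeight s k) := by
  obtain ⟨a, ha, y, hy, rfl⟩ := (mem_body_iff s k x).1 hx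
  have h := facetHeight_pos s k
  rw [add_sub_cancel_left, real_inner_smul_left, inner_sub_outwardNormal s k k hy, if_pos rfl]
  exact ⟨mul_nonneg ha.1 h.le, mul_le_of_le_one_left h.le ha.2⟩

/-- The height of a simplex is at least the diameter of an inscribed ball. -/
theorem two_mul_le_facetHeight [NeZero d] {A : AffineSubspace ℝ (E n)}
    (hA : affineSpan ℝ (Set.range s.points) = A) {z : E n} (hz : z ∈ A) {r : ℝ} (hr : 0 < r)
    (h : Metric.closedBall z r ∩ (A : Set (E n)) ⊆ body s) (k : Fin (d + 1)) :
    2 * r ≤ facetHeight s k := by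
  subst hA
  have hn := norm_outwardNormal s k
  -- The diameter of the ball along the normal lies in the simplex, hence in a slab whose width is
  -- the height.
  have hm : ∀ t : ℝ, |t| ≤ r → z + t • outwardNormal s k ∈ body s := by
    intro t ht
    refine h ⟨?_, ?_⟩
    · simpa [norm_smul, hn] using ht
    · rw [add_comm z]
      refine AffineSubspace.vadd_mem_of_mem_direction (Submodule.smul_mem _ _ ?_) hz
      rw [direction_affineSpan]
      exact outwardNormal_mem s k
  have e : ∀ t : ℝ, inner ℝ (z + t • outwardNormal s k - s.points k) (outwardNormal s k) =
      inner ℝ (z - s.points k) (outwardNormal s k) + t := by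
    intro t
    rw [add_sub_right_comm, inner_add_left, real_inner_smul_left, real_inner_self_eq_norm_sq, hn]
    ring
  have h1 := (inner_sub_outwardNormal_mem_Icc s k (hm r (abs_of_pos hr).le)).2
  have h2 := (inner_sub_outwardNormal_mem_Icc s k (hm (-r) (by simp [abs_of_pos hr]))).1
  rw [e] at h1 h2
  linarith

end Simplex

/-! ### Raviart–Thomas fields on one cell -/

section Affine

variable {n : ℕ} {D : Submodule ℝ (E n)} {p : E n} {v : E n → D}

/-- The upper bound suffices: it is met by the `d + 1` independent basis functions in
`rtPoly_eq_sum`. -/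
theorem finrank_rtPoly_le (D : Submodule ℝ (E n)) (p : E n) :
    Module.Finite ℝ (rtPoly D p) ∧ Module.finrank ℝ (rtPoly D p) ≤ Module.finrank ℝ D + 1 := by
  let F : (D × ℝ) →ₗ[ℝ] (E n → D) :=
    { toFun := fun q x => q.1 + q.2 • D.orthogonalProjectionOnto (x - p)
      map_add' := fun q q' => by
        funext x
        simp only [Prod.fst_add, Prod.snd_add, add_smul, Pi.add_apply]
        abel
      map_smul' := fun r q => by
        funext x
        simp [mul_smul] }
  have h : rtPoly D p = LinearMap.range F := by
    ext u
    constructor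
    · rintro ⟨a, b, h⟩
      exact ⟨(a, b), funext fun x => (h x).symm⟩
    · rintro ⟨⟨a, b⟩, rfl⟩
      exact ⟨a, b, fun x => rfl⟩
  rw [h]
  refine ⟨inferInstance, (LinearMap.finrank_range_le F).trans ?_⟩
  simp

/-- The homothety maps `x` to the midpoint of `x` and `y`, where an affine field takes the mean of
its two values. -/
theorem rtPoly_homothety (hv : v ∈ rtPoly D p) (y x : E n) :
    v y = (2 : ℝ) • v (AffineMap.homothety y (2⁻¹ : ℝ) x) - v x := by
  obtain ⟨a, b, h⟩ := hv
  rw [h, h, h, AffineMap.homothety_apply, vsub_eq_sub, vadd_eq_add]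
  have : (2⁻¹ : ℝ) • (x - y) + y - p = (2⁻¹ : ℝ) • (x - p) + (2⁻¹ : ℝ) • (y - p) := by
    module
  rw [this, map_add, map_smul, map_smul]
  module

/-- The Jacobian factor has the exponent of the Hausdorff measure, not the dimension of the ambient
space. -/
theorem setIntegral_homothety {d : ℕ} (y : E n) (S : Set (E n)) (g : E n → ℝ) :
    ∫ x in S, g (AffineMap.homothety y (2⁻¹ : ℝ) x) ∂μHE[d] =
      2 ^ d * ∫ x in AffineMap.homothety y (2⁻¹ : ℝ) '' S, g x ∂μHE[d] := by
  have h2 : (2⁻¹ : ℝ) ≠ 0 := by norm_num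
  let e : E n ≃ E n := (AffineEquiv.homothetyUnitsMulHom y (Units.mk0 _ h2)).toEquiv
  have he : ⇑e = AffineMap.homothety y (2⁻¹ : ℝ) := by
    ext x
    simp [e]
  have hcont : Continuous (AffineMap.homothety y (2⁻¹ : ℝ) : E n → E n) :=
    AffineMap.homothety_continuous y _
  have hinj : Function.Injective (AffineMap.homothety y (2⁻¹ : ℝ) : E n → E n) := he ▸ e.injective
  have hemb : MeasurableEmbedding (AffineMap.homothety y (2⁻¹ : ℝ) : E n → E n) :=
    hcont.measurableEmbedding hinj
  have hmap : Measure.map (AffineMap.homothety y (2⁻¹ : ℝ)) (μHE[d] : Measure (E n)) =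
      (2 ^ d : NNReal) • (μHE[d] : Measure (E n)) := by
    ext A hA
    rw [Measure.map_apply hcont.measurable hA, euclideanHausdorffMeasure_homothety_preimage _ _ h2]
    simp
  have := hemb.setIntegral_map (μ := (μHE[d] : Measure (E n))) g
    (AffineMap.homothety y (2⁻¹ : ℝ) '' S)
  rw [hinj.preimage_image, hmap, Measure.restrict_smul, integral_smul_nnreal_measure] at this
  rw [← this]
  simp [NNReal.smul_def]

theorem homothety_image_body_subset {d : ℕ} (s : Affine.Simplex ℝ (E n) d) (k : Fin (d + 1)) :
    AffineMap.homothety (s.points k) (2⁻¹ : ℝ) '' body s ⊆ body s := by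
  rintro _ ⟨x, hx, rfl⟩
  rw [AffineMap.homothety_apply, vsub_eq_sub, vadd_eq_add, add_comm]
  exact (convex_body s).add_smul_sub_mem (points_mem_body s k) hx ⟨by norm_num, by norm_num⟩

/-- The vertex values of an affine field are controlled by its mean square. -/
theorem norm_sq_vertex_le {d : ℕ} (s : Affine.Simplex ℝ (E n) d) (hv : v ∈ rtPoly D p)
    (k : Fin (d + 1)) :
    ‖v (s.points k)‖ ^ 2 * (μHE[d] : Measure (E n)).real (body s) ≤
      (2 ^ (d + 3) + 2) * ∫ x in body s, ‖v x‖ ^ 2 ∂μHE[d] := by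
  have hc : Continuous v := (rtPoly_contDiff hv).continuous
  have hcont : Continuous (AffineMap.homothety (s.points k) (2⁻¹ : ℝ) : E n → E n) :=
    AffineMap.homothety_continuous _ _
  -- The vertex value is `2 v(midpoint) - v(x)`, so `(a + b)² ≤ 2 a² + 2 b²` gives the factors 8 and
  -- 2. Substituting the midpoint costs `2 ^ d`, and midpoints stay in the simplex; hence the
  -- constant `8 · 2 ^ d + 2`.
  have hp : ∀ x, ‖v (s.points k)‖ ^ 2 ≤
      8 * ‖v (AffineMap.homothety (s.points k) (2⁻¹ : ℝ) x)‖ ^ 2 + 2 * ‖v x‖ ^ 2 := by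
    intro x
    have h1 := norm_sub_le ((2 : ℝ) • v (AffineMap.homothety (s.points k) (2⁻¹ : ℝ) x)) (v x)
    rw [← rtPoly_homothety hv, norm_smul, Real.norm_ofNat] at h1
    have h2 := norm_nonneg (v (s.points k))
    nlinarith [sq_nonneg (2 * ‖v (AffineMap.homothety (s.points k) (2⁻¹ : ℝ) x)‖ - ‖v x‖)]
  have i1 : IntegrableOn (fun x => 8 * ‖v (AffineMap.homothety (s.points k) (2⁻¹ : ℝ) x)‖ ^ 2)
      (body s) μHE[d] := integrableOn_body s (by fun_prop)
  have i2 : IntegrableOn (fun x => ‖v x‖ ^ 2) (body s) μHE[d] := integrableOn_body s (by fun_prop)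
  have h3 : ∫ x in AffineMap.homothety (s.points k) (2⁻¹ : ℝ) '' body s, ‖v x‖ ^ 2 ∂μHE[d] ≤
      ∫ x in body s, ‖v x‖ ^ 2 ∂μHE[d] :=
    setIntegral_mono_set i2 (Filter.Eventually.of_forall fun x => by positivity)
      (homothety_image_body_subset s k).eventuallyLE
  have h4 : ∫ _ in body s, ‖v (s.points k)‖ ^ 2 ∂μHE[d] ≤
      ∫ x in body s, (8 * ‖v (AffineMap.homothety (s.points k) (2⁻¹ : ℝ) x)‖ ^ 2 + 2 * ‖v x‖ ^ 2)
        ∂μHE[d] :=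
    setIntegral_mono (integrableOn_const (measure_body_lt_top s).ne) (i1.add (i2.const_mul 2)) hp
  rw [integral_add i1 (i2.const_mul 2), integral_const_mul, integral_const_mul,
    setIntegral_homothety (s.points k) (body s) fun x => ‖v x‖ ^ 2, setIntegral_const,
    smul_eq_mul] at h4
  calc _ ≤ 8 * (2 ^ d * ∫ x in AffineMap.homothety (s.points k) (2⁻¹ : ℝ) '' body s,
        ‖v x‖ ^ 2 ∂μHE[d]) + 2 * ∫ x in body s, ‖v x‖ ^ 2 ∂μHE[d] := by linarith
    _ ≤ 8 * (2 ^ d * ∫ x in body s, ‖v x‖ ^ 2 ∂μHE[d]) + 2 * ∫ x in body s, ‖v x‖ ^ 2 ∂μHE[d] := by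
        gcongr
    _ = _ := by ring

theorem continuous_rtBasis {d : ℕ} (s : Affine.Simplex ℝ (E n) d) (k : Fin (d + 1)) :
    Continuous (rtBasis D s k) :=
  (rtPoly_contDiff (rtBasis_mem D s k)).continuous

theorem norm_rtBasis_le {d : ℕ} (s : Affine.Simplex ℝ (E n) d) (k : Fin (d + 1)) {x : E n}
    (hx : x ∈ body s) :
    ‖rtBasis D s k x‖ ≤ (facetHeight s k)⁻¹ * Metric.diam (body s) := by
  have h0 : 0 ≤ facetHeight s k := by
    rcases Nat.eq_zero_or_pos d with rfl | h
    · simp [facetHeight]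
    · have : NeZero d := ⟨h.ne'⟩
      exact (facetHeight_pos s k).le
  rw [rtBasis, norm_smul, norm_inv, Real.norm_of_nonneg h0]
  refine mul_le_mul_of_nonneg_left ?_ (inv_nonneg.2 h0)
  refine (Submodule.norm_orthogonalProjectionOnto_apply_le D _).trans ?_
  rw [← dist_eq_norm]
  exact Metric.dist_le_diam_of_mem (isCompact_body s).isBounded hx (points_mem_body s k)

end Affine

/-! ### Basis property and flux bounds on a cell of the mesh. -/

section Cell

variable {n : ℕ} {M : MixedDimMesh n} {i : M.Sub}

theorem finrank_dir (i : M.Sub) : Module.finrank ℝ (M.dir i) = M.dim i := by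
  obtain ⟨c⟩ := M.cellNonempty i
  rw [MixedDimMesh.dir, ← M.affineSpan_simplex i c, direction_affineSpan]
  exact (M.simplex i c).independent.finrank_vectorSpan (by simp)

theorem subsingleton_dir (h : M.dim i = 0) : Subsingleton (M.dir i) :=
  Module.finrank_zero_iff.1 (by rw [finrank_dir, h])

theorem facetBarycenter_mem {d : ℕ} [NeZero d] (s : Affine.Simplex ℝ (E n) d) (k : Fin (d + 1)) :
    facetBarycenter s k ∈ facet s k := by
  have hd : (0 : ℝ) < d := by exact_mod_cast Nat.pos_of_ne_zero (NeZero.ne d)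
  rw [facetBarycenter, Finset.smul_sum]
  refine (convex_facet s k).sum_mem (fun _ _ => by positivity) ?_ fun j hj =>
    points_mem_facet s (Finset.ne_of_mem_erase hj)
  rw [Finset.sum_const, Finset.card_erase_of_mem (Finset.mem_univ k), Finset.card_univ,
    Fintype.card_fin, Nat.add_sub_cancel, nsmul_eq_mul, mul_inv_cancel₀ hd.ne']

/-- A field on one cell is determined by its normal components. -/
theorem rtPoly_eq_sum {v : E n → M.dir i} (c : M.Cell i)
    (hv : v ∈ rtPoly (M.dir i) ((M.simplex i c).points 0)) :
    v = ∑ k, (inner ℝ (v (facetBarycenter (M.simplex i c) k) : E n)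
      (outwardNormal (M.simplex i c) k) : ℝ) • rtBasis (M.dir i) (M.simplex i c) k := by
  by_cases h0 : M.dim i = 0
  · have := subsingleton_dir h0
    exact Subsingleton.elim _ _
  have : NeZero (M.dim i) := ⟨h0⟩
  let s := M.simplex i c
  let Φ : (Fin (M.dim i + 1) → ℝ) →ₗ[ℝ] rtPoly (M.dir i) (s.points 0) :=
    Fintype.linearCombination ℝ fun k => ⟨rtBasis (M.dir i) s k, rtBasis_mem _ _ _⟩
  have hΦ : ∀ g k, ∀ x ∈ facet s k,
      (inner ℝ ((Φ g).1 x : E n) (outwardNormal s k) : ℝ) = g k := by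
    intro g k x hx
    simp only [Φ, Fintype.linearCombination_apply, Submodule.coe_sum, Submodule.coe_smul,
      Finset.sum_apply, Pi.smul_apply, sum_inner, real_inner_smul_left, s, inner_rtBasis i c k _ hx]
    simp
  have hinj : Function.Injective Φ := by
    intro g g' h
    funext k
    rw [← hΦ g k _ (facetBarycenter_mem s k), h, hΦ g' k _ (facetBarycenter_mem s k)]
  obtain ⟨hfin, hle⟩ := finrank_rtPoly_le (M.dir i) (s.points 0)
  -- Coefficients can be read off as normal components, so the `d + 1` basis functions are
  -- independent in a space of dimension at most `d + 1`.
  have hrank : Module.finrank ℝ (Fin (M.dim i + 1) → ℝ) =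
      Module.finrank ℝ (rtPoly (M.dir i) (s.points 0)) := by
    refine le_antisymm (LinearMap.finrank_le_finrank_of_injective hinj) ?_
    rw [finrank_dir] at hle
    simpa using hle
  obtain ⟨g, hg⟩ := (LinearMap.injective_iff_surjective_of_finrank_eq_finrank hrank).1 hinj ⟨v, hv⟩
  have hg' : (Φ g).1 = v := congrArg Subtype.val hg
  have : ∀ k, (inner ℝ (v (facetBarycenter s k) : E n) (outwardNormal s k) : ℝ) = g k := by
    intro k
    rw [← hg', hΦ g k _ (facetBarycenter_mem s k)]
  simp only [s] at this
  simp only [this]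
  rw [← hg']
  simp [Φ, Fintype.linearCombination_apply, s]

/-- In the basis expansion each normal component is constant on the facet; the barycentre can thus
be exchanged for a vertex, where `norm_sq_vertex_le` applies. -/
theorem inner_eq_of_mem_facet {v : E n → M.dir i} (c : M.Cell i)
    (hv : v ∈ rtPoly (M.dir i) ((M.simplex i c).points 0)) (k : Fin (M.dim i + 1)) {x : E n}
    (hx : x ∈ facet (M.simplex i c) k) :
    (inner ℝ (v x : E n) (outwardNormal (M.simplex i c) k) : ℝ) =
      inner ℝ (v (facetBarycenter (M.simplex i c) k) : E n) (outwardNormal (M.simplex i c) k) := by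
  conv_lhs => rw [rtPoly_eq_sum c hv]
  simp only [Finset.sum_apply, Pi.smul_apply, Submodule.coe_sum, Submodule.coe_smul, sum_inner,
    real_inner_smul_left, inner_rtBasis i c k _ hx]
  simp

/-- The normal components of a field are controlled by its mean square. -/
theorem inner_sq_le {v : E n → M.dir i} (c : M.Cell i)
    (hv : v ∈ rtPoly (M.dir i) ((M.simplex i c).points 0)) (k : Fin (M.dim i + 1))
    [NeZero (M.dim i)] :
    (inner ℝ (v (facetBarycenter (M.simplex i c) k) : E n) (outwardNormal (M.simplex i c) k) : ℝ) ^ 2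
      * (μHE[M.dim i] : Measure (E n)).real (body (M.simplex i c)) ≤
      (2 ^ (M.dim i + 3) + 2) * ∫ x in body (M.simplex i c), ‖v x‖ ^ 2 ∂μHE[M.dim i] := by
  have : Nontrivial (Fin (M.dim i + 1)) := Fin.nontrivial_iff_two_le.2 (by
    have := NeZero.ne (M.dim i); omega)
  -- Every vertex other than `k` lies on the facet opposite to `k`.
  obtain ⟨j, hj⟩ := exists_ne k
  refine le_trans ?_ (norm_sq_vertex_le (M.simplex i c) hv j)
  refine mul_le_mul_of_nonneg_right ?_ measureReal_nonneg
  rw [← inner_eq_of_mem_facet c hv k (points_mem_facet _ hj)]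
  have h := abs_real_inner_le_norm (v ((M.simplex i c).points j) : E n)
    (outwardNormal (M.simplex i c) k)
  rw [norm_outwardNormal, mul_one] at h
  rw [← sq_abs]
  exact pow_le_pow_left₀ (abs_nonneg _) h 2

end Cell

/-! ### Bounds for the quadratic form of the inverse permeability. -/

section Permeability

variable {n : ℕ} {M : MixedDimMesh n} (P : Params M)

theorem K_symm_symm (i : M.Sub) (u v : M.dir i) :
    (inner ℝ ((P.K i).symm u) v : ℝ) = inner ℝ u ((P.K i).symm v) := by
  have := P.K_symm i ((P.K i).symm u) ((P.K i).symm v)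
  simpa using this.symm

theorem K_symm_nonneg (i : M.Sub) (u : M.dir i) : (0 : ℝ) ≤ inner ℝ ((P.K i).symm u) u := by
  by_cases h : (P.K i).symm u = 0
  · simp [h]
  · have := P.K_pos i _ h
    rw [LinearEquiv.apply_symm_apply, real_inner_comm] at this
    exact this.le

/-- The form of `K⁻¹` is nonnegative on every difference `w k - w j`; summed over all pairs, this is
twice the difference of the two sides. -/
theorem K_symm_sum_le (i : M.Sub) {ι : Type*} [Fintype ι] (w : ι → M.dir i) :
    (inner ℝ ((P.K i).symm (∑ k, w k)) (∑ k, w k) : ℝ) ≤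
      Fintype.card ι * ∑ k, (inner ℝ ((P.K i).symm (w k)) (w k) : ℝ) := by
  have h : (0 : ℝ) ≤ ∑ k, ∑ j, (inner ℝ ((P.K i).symm (w k - w j)) (w k - w j) : ℝ) :=
    Finset.sum_nonneg fun k _ => Finset.sum_nonneg fun j _ => K_symm_nonneg P i _
  have e : ∀ k j, (inner ℝ ((P.K i).symm (w k - w j)) (w k - w j) : ℝ) =
      inner ℝ ((P.K i).symm (w k)) (w k) + inner ℝ ((P.K i).symm (w j)) (w j)
        - 2 * inner ℝ ((P.K i).symm (w k)) (w j) := by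
    intro k j
    have := (K_symm_symm P i (w j) (w k)).trans (real_inner_comm _ _)
    simp only [map_sub, inner_sub_left, inner_sub_right]
    linarith
  simp only [e, Finset.sum_sub_distrib, Finset.sum_add_distrib, Finset.sum_const,
    ← Finset.mul_sum, Finset.card_univ, nsmul_eq_mul] at h
  rw [map_sum]
  simp only [sum_inner, inner_sum]
  rw [Finset.sum_comm]
  linarith

variable {P}

/-- Insert `v = K⁻¹ u`: then `κ ‖v‖² ≤ (u, v) ≤ ‖u‖ ‖v‖`, hence `‖v‖ ≤ κ⁻¹ ‖u‖`. -/
theorem K_symm_le {i : M.Sub} {κ : ℝ} (hκ : 0 < κ)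
    (h : ∀ v : M.dir i, κ * ‖v‖ ^ 2 ≤ inner ℝ (P.K i v) v) (u : M.dir i) :
    (inner ℝ ((P.K i).symm u) u : ℝ) ≤ κ⁻¹ * ‖u‖ ^ 2 := by
  have h1 := h ((P.K i).symm u)
  rw [LinearEquiv.apply_symm_apply] at h1
  have h2 := real_inner_le_norm ((P.K i).symm u) u
  rw [real_inner_comm] at h1
  set a := ‖(P.K i).symm u‖ with ha
  have ha0 : 0 ≤ a := norm_nonneg _
  have hb0 : 0 ≤ ‖u‖ := norm_nonneg _
  have h3 : κ * a ≤ ‖u‖ := by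
    rcases ha0.eq_or_lt with h0 | h0
    · simp [← h0]
    · nlinarith
  have h4 : a ≤ κ⁻¹ * ‖u‖ := by rw [inv_mul_eq_div, le_div_iff₀ hκ]; linarith
  nlinarith

/-- The form of `K` is nonnegative at `t K⁻¹ u - u`, that is `0 ≤ t² (K⁻¹ u, u) - 2 t ‖u‖² + (K u,
u)`; bound the last term by `t ‖u‖²` and divide by `t`. -/
theorem le_K_symm {i : M.Sub} {t : ℝ}
    (h : ∀ v : M.dir i, (inner ℝ (P.K i v) v : ℝ) ≤ t * ‖v‖ ^ 2) (u : M.dir i) :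
    ‖u‖ ^ 2 ≤ t * inner ℝ ((P.K i).symm u) u := by
  by_cases hu : u = 0
  · simp [hu]
  have hu2 : 0 < ‖u‖ ^ 2 := by positivity
  have ht : 0 < t := pos_of_mul_pos_left ((P.K_pos i u hu).trans_le (h u)) hu2.le
  have hpos : (0 : ℝ) ≤ inner ℝ (P.K i (t • (P.K i).symm u - u)) (t • (P.K i).symm u - u) := by
    have := K_symm_nonneg P i (P.K i (t • (P.K i).symm u - u))
    rwa [LinearEquiv.symm_apply_apply, real_inner_comm] at this
  have h1 : (inner ℝ (P.K i u) ((P.K i).symm u) : ℝ) = ‖u‖ ^ 2 := by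
    rw [P.K_symm, LinearEquiv.apply_symm_apply, real_inner_self_eq_norm_sq]
  have h2 : (inner ℝ u ((P.K i).symm u) : ℝ) = inner ℝ ((P.K i).symm u) u := real_inner_comm _ _
  have h5 (x y : M.dir i) : (inner ℝ (t • x) y : ℝ) = t * inner ℝ x y :=
    real_inner_smul_left (F := M.dir i) _ _ _
  have h6 (x y : M.dir i) : (inner ℝ x (t • y) : ℝ) = t * inner ℝ x y :=
    real_inner_smul_right (F := M.dir i) _ _ _
  have h7 : (inner ℝ u u : ℝ) = ‖u‖ ^ 2 := real_inner_self_eq_norm_sq (F := M.dir i) u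
  simp only [map_sub, map_smul, LinearEquiv.apply_symm_apply, inner_sub_left, inner_sub_right,
    h5, h6, h1, h2, h7] at hpos
  have h3 := h u
  have h4 : 0 ≤ t * (t * inner ℝ ((P.K i).symm u) u - ‖u‖ ^ 2) := by linarith
  have := nonneg_of_mul_nonneg_right h4 ht
  linarith

end Permeability

noncomputable section

variable {n : ℕ} {M : MixedDimMesh n}

/-! ### Fluxes through facets -/

/-- The constant normal component of a field on a facet. -/
def flux (v : Field M) (i : M.Sub) (c : M.Cell i) (k : Fin (M.dim i + 1)) : ℝ :=
  normalTrace v i c k (facetBarycenter (M.simplex i c) k)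

/-- The elementwise `RT₀` field with given normal components. -/
def ofFlux (g : ∀ i, M.Cell i → Fin (M.dim i + 1) → ℝ) : Field M :=
  fun i c x => ∑ k, g i c k • rtBasis (M.dir i) (M.simplex i c) k x

theorem normalTrace_ofFlux (g : ∀ i, M.Cell i → Fin (M.dim i + 1) → ℝ) (i : M.Sub) (c : M.Cell i)
    (k : Fin (M.dim i + 1)) {x : E n} (hx : x ∈ facet (M.simplex i c) k) :
    normalTrace (ofFlux g) i c k x = g i c k := by
  simp only [normalTrace, ofFlux, Submodule.coe_sum, Submodule.coe_smul, sum_inner,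
    real_inner_smul_left, inner_rtBasis i c k _ hx]
  simp

theorem ofFlux_eq_sum (g : ∀ i, M.Cell i → Fin (M.dim i + 1) → ℝ) (i : M.Sub) (c : M.Cell i) :
    ofFlux g i c = ∑ k, g i c k • rtBasis (M.dir i) (M.simplex i c) k := by
  ext x
  simp [ofFlux]

theorem ofFlux_mem {g : ∀ i, M.Cell i → Fin (M.dim i + 1) → ℝ}
    (h1 : ∀ i c k c' k', M.kind i c k = .interior c' k' → g i c k + g i c' k' = 0)
    (h2 : ∀ i c k, M.kind i c k = .neumann → g i c k = 0) : ofFlux g ∈ V M := by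
  refine ⟨fun i c => ?_, fun i c k c' k' hk x hx => ?_, fun i c k hk x hx => ?_⟩
  · rw [ofFlux_eq_sum]
    exact Submodule.sum_mem _ fun k _ => Submodule.smul_mem _ _ (rtBasis_mem _ _ _)
  · have hx' : x ∈ facet (M.simplex i c') k' := (M.interior_shared i c k c' k' hk).2 ▸ hx
    rw [normalTrace_ofFlux g i c k hx, normalTrace_ofFlux g i c' k' hx', h1 i c k c' k' hk]
  · rw [normalTrace_ofFlux g i c k hx, h2 i c k hk]

theorem eq_sum_flux (v : V M) (i : M.Sub) (c : M.Cell i) :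
    v.1 i c = ∑ k, flux v.1 i c k • rtBasis (M.dir i) (M.simplex i c) k :=
  rtPoly_eq_sum c (v.2.1 i c)

theorem eq_zero_of_flux {v : V M} (h : ∀ i c k, flux v.1 i c k = 0) : v = 0 := by
  refine Subtype.ext ?_
  funext i c
  rw [eq_sum_flux v i c]
  simp [h]

instance finiteDimensional_V : FiniteDimensional ℝ (V M) := by
  let F : V M →ₗ[ℝ] (∀ i, M.Cell i → Fin (M.dim i + 1) → ℝ) :=
    { toFun := fun v => flux v.1
      map_add' := fun u v => by
        funext i c k
        exact normalTrace_add u.1 v.1 i c k _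
      map_smul' := fun r v => by
        funext i c k
        exact normalTrace_smul r v.1 i c k _ }
  refine FiniteDimensional.of_injective F ((injective_iff_map_eq_zero F).2 fun v hv => ?_)
  exact eq_zero_of_flux fun i c k => congrFun (congrFun (congrFun hv i) c) k

/-! ### Equivalence of the mass form and its diagonal part -/

variable (P : Params M)

theorem massForm_apply (u v : V M) : massForm P u v = ∑ i, ∑ c, ∫ x in body (M.simplex i c),
    (inner ℝ ((P.K i).symm (u.1 i c x)) (v.1 i c x) : ℝ) ∂μHE[M.dim i] := rfl

theorem diagMassForm_apply (u v : V M) : diagMassForm P u v = ∑ i, ∑ c, ∑ k,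
    flux u.1 i c k * flux v.1 i c k * ∫ x in body (M.simplex i c),
      (inner ℝ ((P.K i).symm (rtBasis (M.dir i) (M.simplex i c) k x))
        (rtBasis (M.dir i) (M.simplex i c) k x) : ℝ) ∂μHE[M.dim i] := rfl

theorem massForm_symm (u v : V M) : massForm P u v = massForm P v u := by
  simp only [massForm_apply]
  refine Finset.sum_congr rfl fun i _ => Finset.sum_congr rfl fun c _ => ?_
  congr 1
  funext x
  rw [K_symm_symm, real_inner_comm]

theorem diagMassForm_symm (u v : V M) : diagMassForm P u v = diagMassForm P v u := by
  simp only [diagMassForm_apply]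
  refine Finset.sum_congr rfl fun i _ => Finset.sum_congr rfl fun c _ =>
    Finset.sum_congr rfl fun k _ => ?_
  ring

theorem mortarForm_symm (l μ : Lam M) : mortarForm P l μ = mortarForm P μ l := by
  simp only [mortarForm, LinearMap.mk₂_apply]
  refine Finset.sum_congr rfl fun e _ => Finset.sum_congr rfl fun m _ => ?_
  congr 1
  funext x
  ring

theorem integrableOn_K_symm {i : M.Sub} (c : M.Cell i) {v : E n → M.dir i} (hv : Continuous v) :
    IntegrableOn (fun x => (inner ℝ ((P.K i).symm (v x)) (v x) : ℝ))
      (body (M.simplex i c)) μHE[M.dim i] := by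
  refine integrableOn_body _ ?_
  exact (((P.K i).symm.toLinearMap.continuous_of_finiteDimensional).comp hv).inner hv

theorem integral_K_symm_nonneg {i : M.Sub} (c : M.Cell i) (v : E n → M.dir i) :
    0 ≤ ∫ x in body (M.simplex i c), (inner ℝ ((P.K i).symm (v x)) (v x) : ℝ) ∂μHE[M.dim i] :=
  integral_nonneg fun _ => K_symm_nonneg P i _

theorem massForm_nonneg (v : V M) : 0 ≤ massForm P v v :=
  Finset.sum_nonneg fun _ _ => Finset.sum_nonneg fun c _ => integral_K_symm_nonneg P c _

/-- Pointwise `K_symm_sum_le` for the basis expansion; 4 is the largest number `d + 1` of facets.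
The shape of the cells plays no role in this direction. -/
theorem massForm_self_le (hn : n ≤ 3) (v : V M) : massForm P v v ≤ 4 * diagMassForm P v v := by
  rw [massForm_apply, diagMassForm_apply, Finset.mul_sum]
  refine Finset.sum_le_sum fun i _ => ?_
  rw [Finset.mul_sum]
  refine Finset.sum_le_sum fun c _ => ?_
  have h4 : ((Fintype.card (Fin (M.dim i + 1)) : ℕ) : ℝ) ≤ 4 := by
    have := M.dim_le i
    rw [Fintype.card_fin]
    exact_mod_cast (by omega : M.dim i + 1 ≤ 4)
  have hi : ∀ k, IntegrableOn (fun x => flux v.1 i c k * flux v.1 i c k *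
      (inner ℝ ((P.K i).symm (rtBasis (M.dir i) (M.simplex i c) k x))
        (rtBasis (M.dir i) (M.simplex i c) k x) : ℝ)) (body (M.simplex i c)) μHE[M.dim i] :=
    fun k => (integrableOn_K_symm P c (continuous_rtBasis _ k)).const_mul _
  simp only [← integral_const_mul]
  rw [← integral_finsetSum _ fun k _ => hi k, ← integral_const_mul]
  refine setIntegral_mono (integrableOn_K_symm P c (V_contDiff v i c).continuous)
    ((integrable_finsetSum _ fun k _ => hi k).const_mul 4) fun x => ?_
  have h := K_symm_sum_le P i fun k => flux v.1 i c k • rtBasis (M.dir i) (M.simplex i c) k x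
  have e : v.1 i c x = ∑ k, flux v.1 i c k • rtBasis (M.dir i) (M.simplex i c) k x := by
    conv_lhs => rw [eq_sum_flux v i c]
    simp
  have e2 : ∀ k, (inner ℝ ((P.K i).symm (flux v.1 i c k • rtBasis (M.dir i) (M.simplex i c) k x))
      (flux v.1 i c k • rtBasis (M.dir i) (M.simplex i c) k x) : ℝ) =
      flux v.1 i c k * flux v.1 i c k *
      (inner ℝ ((P.K i).symm (rtBasis (M.dir i) (M.simplex i c) k x))
        (rtBasis (M.dir i) (M.simplex i c) k x) : ℝ) := by
    intro k
    rw [map_smul, real_inner_smul_right (F := M.dir i), mul_assoc]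
    congr 1
    exact real_inner_smul_left (F := M.dir i) _ _ _
  simp only [e2, ← e] at h
  refine h.trans (mul_le_mul_of_nonneg_right h4 (Finset.sum_nonneg fun k _ => ?_))
  exact mul_nonneg (mul_self_nonneg _) (K_symm_nonneg P i _)

theorem integral_norm_sq_le {i : M.Sub} {t : ℝ}
    (h : ∀ v : M.dir i, (inner ℝ (P.K i v) v : ℝ) ≤ t * ‖v‖ ^ 2) (c : M.Cell i)
    {v : E n → M.dir i} (hv : Continuous v) :
    ∫ x in body (M.simplex i c), ‖v x‖ ^ 2 ∂μHE[M.dim i] ≤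
      t * ∫ x in body (M.simplex i c), (inner ℝ ((P.K i).symm (v x)) (v x) : ℝ) ∂μHE[M.dim i] := by
  rw [← integral_const_mul]
  exact setIntegral_mono (integrableOn_body _ (by fun_prop))
    ((integrableOn_K_symm P c hv).const_mul t) fun x => le_K_symm h (v x)

variable {P}

/-- A scaling argument on each cell. The basis function brings `κ⁻¹ σ²` times the volume, the
squared flux is bounded by the mean square over the volume, and the mean square by `τ κ` times the
energy; both `κ` and the volume cancel. Here `264 = 4 · 66` counts at most four facets, and `66 = 2
^ 6 + 2` is the constant of `inner_sq_le` for `d = 3`. -/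
theorem diagMassForm_self_le (hn : n ≤ 3) {σ τ : ℝ} (hσ : M.ShapeRegular σ)
    (hτ : P.AnisotropyLE τ) (v : V M) :
    diagMassForm P v v ≤ 264 * σ ^ 2 * |τ| * massForm P v v := by
  rw [massForm_apply, diagMassForm_apply, Finset.mul_sum]
  refine Finset.sum_le_sum fun i _ => ?_
  rw [Finset.mul_sum]
  refine Finset.sum_le_sum fun c _ => ?_
  set Mv := ∫ x in body (M.simplex i c), (inner ℝ ((P.K i).symm (v.1 i c x)) (v.1 i c x) : ℝ)
    ∂μHE[M.dim i] with hMv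
  have hMv0 : 0 ≤ Mv := integral_K_symm_nonneg P c _
  have hbound : ∀ k, flux v.1 i c k * flux v.1 i c k * ∫ x in body (M.simplex i c),
      (inner ℝ ((P.K i).symm (rtBasis (M.dir i) (M.simplex i c) k x))
        (rtBasis (M.dir i) (M.simplex i c) k x) : ℝ) ∂μHE[M.dim i] ≤
      66 * σ ^ 2 * |τ| * Mv := by
    intro k
    by_cases h0 : M.dim i = 0
    · have := subsingleton_dir h0
      have : (fun x => (inner ℝ ((P.K i).symm (rtBasis (M.dir i) (M.simplex i c) k x))
        (rtBasis (M.dir i) (M.simplex i c) k x) : ℝ)) = fun _ => 0 := by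
        funext x
        rw [Subsingleton.elim (rtBasis (M.dir i) (M.simplex i c) k x) 0, inner_zero_right]
      rw [this, integral_zero, mul_zero]
      positivity
    have : NeZero (M.dim i) := ⟨h0⟩
    obtain ⟨κ, hκ, hK⟩ := hτ i
    obtain ⟨z, hz, r, hr, hball, hdiam⟩ := hσ i c
    have hh := two_mul_le_facetHeight (M.simplex i c) (M.affineSpan_simplex i c) hz hr hball k
    have hhpos := facetHeight_pos (M.simplex i c) k
    -- On the cell `‖φ‖ ≤ diam / height ≤ σ`, because the height is at least the diameter `2 r` of
    -- the inscribed ball.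
    have hφ : ∀ x ∈ body (M.simplex i c),
        (inner ℝ ((P.K i).symm (rtBasis (M.dir i) (M.simplex i c) k x))
          (rtBasis (M.dir i) (M.simplex i c) k x) : ℝ) ≤ κ⁻¹ * σ ^ 2 := by
      intro x hx
      refine (K_symm_le hκ (fun v => (hK v).1) _).trans ?_
      refine mul_le_mul_of_nonneg_left ?_ (inv_nonneg.2 hκ.le)
      have hd0 : 0 ≤ Metric.diam (body (M.simplex i c)) := Metric.diam_nonneg
      have hσ0 : 0 ≤ σ := by
        by_contra! hneg
        nlinarith
      refine pow_le_pow_left₀ (norm_nonneg _) ((norm_rtBasis_le _ k hx).trans ?_) 2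
      rw [inv_mul_le_iff₀ hhpos]
      nlinarith
    have h1 : ∫ x in body (M.simplex i c),
        (inner ℝ ((P.K i).symm (rtBasis (M.dir i) (M.simplex i c) k x))
          (rtBasis (M.dir i) (M.simplex i c) k x) : ℝ) ∂μHE[M.dim i] ≤
        κ⁻¹ * σ ^ 2 * (μHE[M.dim i] : Measure (E n)).real (body (M.simplex i c)) := by
      have := setIntegral_mono_on (integrableOn_K_symm P c (continuous_rtBasis _ k))
        (integrableOn_const (measure_body_lt_top _).ne) (isCompact_body _).measurableSet hφ
      rwa [setIntegral_const, smul_eq_mul, mul_comm] at this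
    have h2 := inner_sq_le c (v.2.1 i c) k
    -- The absolute value makes the final constant nonnegative for every real `τ`.
    have h3 := integral_norm_sq_le P (t := |τ| * κ) (fun u => (hK u).2.trans
      (by gcongr; exact le_abs_self τ)) c (V_contDiff v i c).continuous
    have hpow : (2 : ℝ) ^ (M.dim i + 3) + 2 ≤ 66 := by
      have : (2 : ℝ) ^ (M.dim i + 3) ≤ 2 ^ 6 :=
        pow_le_pow_right₀ (by norm_num) (by have := M.dim_le i; omega)
      linarith
    change flux v.1 i c k ^ 2 * _ ≤ _ at h2
    have hN0 : 0 ≤ ∫ x in body (M.simplex i c), ‖v.1 i c x‖ ^ 2 ∂μHE[M.dim i] :=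
      integral_nonneg fun _ => by positivity
    calc _ ≤ flux v.1 i c k * flux v.1 i c k *
          (κ⁻¹ * σ ^ 2 * (μHE[M.dim i] : Measure (E n)).real (body (M.simplex i c))) :=
          mul_le_mul_of_nonneg_left h1 (mul_self_nonneg _)
      _ = κ⁻¹ * σ ^ 2 * (flux v.1 i c k ^ 2 *
          (μHE[M.dim i] : Measure (E n)).real (body (M.simplex i c))) := by ring
      _ ≤ κ⁻¹ * σ ^ 2 * (66 * (|τ| * κ * Mv)) := by
          refine mul_le_mul_of_nonneg_left (h2.trans ?_) (by positivity)
          exact mul_le_mul hpow h3 hN0 (by norm_num)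
      _ = 66 * σ ^ 2 * |τ| * Mv * (κ⁻¹ * κ) := by ring
      _ = _ := by rw [inv_mul_cancel₀ hκ.ne', mul_one]
  refine (Finset.sum_le_sum fun k _ => hbound k).trans ?_
  rw [Finset.sum_const, Finset.card_univ, Fintype.card_fin, nsmul_eq_mul]
  have h4 : ((M.dim i + 1 : ℕ) : ℝ) ≤ 4 := by
    have := M.dim_le i
    exact_mod_cast (by omega : M.dim i + 1 ≤ 4)
  have h5 : 0 ≤ 66 * σ ^ 2 * |τ| * Mv := by positivity
  nlinarith

/-- Zero energy makes the mean square vanish on every cell, and then `inner_sq_le` makes all fluxes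
vanish. -/
theorem massForm_pos {τ : ℝ} (hτ : P.AnisotropyLE τ) {v : V M} (hv : v ≠ 0) :
    0 < massForm P v v := by
  refine (massForm_nonneg P v).lt_of_ne fun h => hv (eq_zero_of_flux fun i c k => ?_)
  by_cases h0 : M.dim i = 0
  · have := subsingleton_dir h0
    rw [flux, normalTrace, Subsingleton.elim (v.1 i c _) 0, Submodule.coe_zero, inner_zero_left]
  have : NeZero (M.dim i) := ⟨h0⟩
  rw [massForm_apply] at h
  have h1 := (Finset.sum_eq_zero_iff_of_nonneg fun i _ => Finset.sum_nonneg fun c _ =>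
    integral_K_symm_nonneg P c (v.1 i c)).1 h.symm i (Finset.mem_univ i)
  have h2 := (Finset.sum_eq_zero_iff_of_nonneg fun c _ =>
    integral_K_symm_nonneg P c (v.1 i c)).1 h1 c (Finset.mem_univ c)
  obtain ⟨κ, hκ, hK⟩ := hτ i
  have h3 := integral_norm_sq_le P (fun u => (hK u).2) c (V_contDiff v i c).continuous
  rw [h2, mul_zero] at h3
  have h4 := inner_sq_le c (v.2.1 i c) k
  change flux v.1 i c k ^ 2 * _ ≤ _ at h4
  have h5 := measureReal_body_pos (M.simplex i c)
  have h6 : flux v.1 i c k ^ 2 * (μHE[M.dim i] : Measure (E n)).real (body (M.simplex i c)) ≤ 0 :=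
    h4.trans (mul_nonpos_of_nonneg_of_nonpos (by positivity) h3)
  have h7 : flux v.1 i c k ^ 2 ≤ 0 := nonpos_of_mul_nonpos_left h6 h5
  exact pow_eq_zero_iff (two_ne_zero) |>.1 (le_antisymm h7 (sq_nonneg _))

/-! ### Positivity of the mortar form. -/

variable (P)

/-- On piecewise constants this form is already diagonal, which is why `a^D` keeps it unchanged. -/
theorem mortarForm_apply (l μ : Lam M) : mortarForm P l μ = ∑ e, ∑ m, l e m * μ e m *
    ∫ x in body (M.msimplex e m), P.γ e * (P.Kν e x)⁻¹ ∂μHE[M.dim (M.low e)] := by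
  simp only [mortarForm, LinearMap.mk₂_apply, integral_mul_const]
  refine Finset.sum_congr rfl fun e _ => Finset.sum_congr rfl fun m _ => ?_
  ring

/-- The upper bound of `Kν` keeps the integrand away from zero. The lower bound and measurability
give integrability, without which the integral would have the default value 0. -/
theorem mortarWeight_pos (e : M.Iface) (m : M.MCell e) :
    0 < ∫ x in body (M.msimplex e m), P.γ e * (P.Kν e x)⁻¹ ∂μHE[M.dim (M.low e)] := by
  obtain ⟨a, b, ha, hab⟩ := P.Kν_bounds e
  have hb : 0 < b := by
    have := hab m _ (points_mem_body (M.msimplex e m) 0)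
    linarith
  have hγ := P.γ_pos e
  rw [integral_const_mul]
  refine mul_pos hγ (lt_of_lt_of_le (mul_pos (measureReal_body_pos (M.msimplex e m))
    (inv_pos.2 hb)) ?_)
  have hm := (isCompact_body (M.msimplex e m)).measurableSet
  rw [← smul_eq_mul, ← setIntegral_const]
  refine setIntegral_mono_on (integrableOn_const (measure_body_lt_top _).ne) ?_ hm fun x hx => ?_
  · refine IntegrableOn.of_bound (measure_body_lt_top _)
      (P.Kν_measurable e).inv.aestronglyMeasurable a⁻¹ ?_
    refine (ae_restrict_iff' hm).2 (Filter.Eventually.of_forall fun x hx => ?_)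
    have h := (hab m x hx).1
    rw [Real.norm_of_nonneg (inv_nonneg.2 (ha.le.trans h))]
    exact inv_anti₀ ha h
  · obtain ⟨h1, h2⟩ := hab m x hx
    exact inv_anti₀ (ha.trans_le h1) h2

theorem mortarForm_nonneg (μ : Lam M) : 0 ≤ mortarForm P μ μ := by
  rw [mortarForm_apply]
  exact Finset.sum_nonneg fun e _ => Finset.sum_nonneg fun m _ =>
    mul_nonneg (mul_self_nonneg _) (mortarWeight_pos P e m).le

theorem mortarForm_pos {μ : Lam M} (hμ : μ ≠ 0) : 0 < mortarForm P μ μ := by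
  obtain ⟨e, he⟩ := Function.ne_iff.1 hμ
  obtain ⟨m, hm⟩ := Function.ne_iff.1 he
  have h : ∀ e m, 0 ≤ μ e m * μ e m *
      ∫ x in body (M.msimplex e m), P.γ e * (P.Kν e x)⁻¹ ∂μHE[M.dim (M.low e)] := fun e m =>
    mul_nonneg (mul_self_nonneg _) (mortarWeight_pos P e m).le
  rw [mortarForm_apply]
  refine Finset.sum_pos' (fun e _ => Finset.sum_nonneg fun m _ => h e m)
    ⟨e, Finset.mem_univ e, Finset.sum_pos' (fun m _ => h e m) ⟨m, Finset.mem_univ m, ?_⟩⟩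
  exact mul_pos (mul_self_pos.2 hm) (mortarWeight_pos P e m)

/-! ### The forms on `W_h` -/

theorem aForm_apply (w r : W M) :
    aForm P w r = massForm P (total M w) (total M r) + mortarForm P w.2 r.2 := rfl

theorem aDForm_apply (w r : W M) :
    aDForm P w r = diagMassForm P (total M w) (total M r) + mortarForm P w.2 r.2 := rfl

theorem aForm_symm (w r : W M) : aForm P w r = aForm P r w := by
  rw [aForm_apply, aForm_apply, massForm_symm, mortarForm_symm]

theorem aDForm_symm (w r : W M) : aDForm P w r = aDForm P r w := by
  rw [aDForm_apply, aDForm_apply, diagMassForm_symm, mortarForm_symm]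

theorem aForm_self_le (hn : n ≤ 3) (r : W M) : aForm P r r ≤ 4 * aDForm P r r := by
  rw [aForm_apply, aDForm_apply]
  have h1 := massForm_self_le P hn (total M r)
  have h2 := mortarForm_nonneg P r.2
  linarith

variable {P}

/-- The summand 1 in the constant covers the mortar term common to both forms. -/
theorem aDForm_self_le (hn : n ≤ 3) {σ τ : ℝ} (hσ : M.ShapeRegular σ) (hτ : P.AnisotropyLE τ)
    (r : W M) : aDForm P r r ≤ (264 * σ ^ 2 * |τ| + 1) * aForm P r r := by
  rw [aForm_apply, aDForm_apply]
  have h1 := diagMassForm_self_le hn hσ hτ (total M r)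
  have h2 := mortarForm_nonneg P r.2
  have h3 := massForm_nonneg P (total M r)
  have h4 : 0 ≤ 264 * σ ^ 2 * |τ| := by positivity
  nlinarith

theorem aForm_pos {τ : ℝ} (hτ : P.AnisotropyLE τ) {r : W M} (hr : r ≠ 0) : 0 < aForm P r r := by
  rw [aForm_apply]
  by_cases h : r.2 = 0
  -- Without a mortar part the extension vanishes, and the total flux is the first component itself.
  · have ht : total M r ≠ 0 := by
      intro h0
      refine hr (Prod.ext (Subtype.ext ?_) h)
      simpa [total, h] using h0
    exact add_pos_of_pos_of_nonneg (massForm_pos hτ ht) (mortarForm_nonneg P _)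
  · exact add_pos_of_nonneg_of_pos (massForm_nonneg P _) (mortarForm_pos P h)

/-! ### The divergence in terms of fluxes -/

/-- The area of a facet of a cell (zero for a cell of dimension zero). -/
def facetArea (M : MixedDimMesh n) (i : M.Sub) (c : M.Cell i) (k : Fin (M.dim i + 1)) : ℝ :=
  (μHE[M.dim i - 1] : Measure (E n)).real (facet (M.simplex i c) k)

theorem facet_eq_empty {d : ℕ} (hd : d = 0) (s : Affine.Simplex ℝ (E n) d) (k : Fin (d + 1)) :
    facet s k = ∅ := by
  have : ({k}ᶜ : Set (Fin (d + 1))) = ∅ := by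
    ext a
    have : a = k := Fin.ext (by omega)
    simp [this]
  simp [facet, this]

theorem facetArea_eq (i : M.Sub) (c : M.Cell i) (k : Fin (M.dim i + 1)) :
    (facetHeight (M.simplex i c) k)⁻¹ * M.dim i *
      (μHE[M.dim i] : Measure (E n)).real (body (M.simplex i c)) = facetArea M i c k := by
  by_cases h0 : M.dim i = 0
  · have h : ((M.dim i : ℕ) : ℝ) = 0 := by exact_mod_cast h0
    rw [facetArea, facet_eq_empty h0, h]
    simp
  · have : NeZero (M.dim i) := ⟨h0⟩
    exact measureReal_facet_eq _ k

theorem facetArea_pos (i : M.Sub) (c : M.Cell i) (k : Fin (M.dim i + 1)) (h : M.dim i ≠ 0) :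
    0 < facetArea M i c k := by
  have : NeZero (M.dim i) := ⟨h⟩
  exact ENNReal.toReal_pos (measure_facet_pos _ k).ne' (measure_facet_lt_top _ k).ne

theorem tangentialDiv_rtBasis {D : Submodule ℝ (E n)} {d : ℕ} (s : Affine.Simplex ℝ (E n) d)
    (k : Fin (d + 1)) (x : E n) :
    tangentialDiv (rtBasis D s k) x = (facetHeight s k)⁻¹ * Module.finrank ℝ D := by
  have h : HasFDerivAt (rtBasis D s k) ((facetHeight s k)⁻¹ • D.orthogonalProjectionOnto) x := by
    have h := ((D.orthogonalProjectionOnto.hasFDerivAt).comp x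
      ((hasFDerivAt_id x).sub_const (s.points k))).const_smul (facetHeight s k)⁻¹
    rw [ContinuousLinearMap.comp_id] at h
    exact h
  rw [tangentialDiv, h.fderiv]
  have e : ((facetHeight s k)⁻¹ • D.orthogonalProjectionOnto).toLinearMap ∘ₗ D.subtype =
      (facetHeight s k)⁻¹ • LinearMap.id := by
    ext y
    simp
  rw [e, map_smul, LinearMap.trace_id, smul_eq_mul]

theorem tangentialDiv_eq (v : V M) (i : M.Sub) (c : M.Cell i) (x : E n) :
    tangentialDiv (v.1 i c) x =
      ∑ k, flux v.1 i c k * ((facetHeight (M.simplex i c) k)⁻¹ * M.dim i) := by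
  have hd : ∀ k, Differentiable ℝ (rtBasis (M.dir i) (M.simplex i c) k) := fun k =>
    (rtPoly_contDiff (rtBasis_mem _ _ k)).differentiable (by norm_num)
  have h : ∀ s : Finset (Fin (M.dim i + 1)),
      tangentialDiv (∑ k ∈ s, flux v.1 i c k • rtBasis (M.dir i) (M.simplex i c) k) x =
      ∑ k ∈ s, flux v.1 i c k * ((facetHeight (M.simplex i c) k)⁻¹ * M.dim i) := by
    classical
    intro s
    induction s using Finset.induction_on with
    | empty => simp [tangentialDiv]
    | insert k s hk ih =>
      have hs : Differentiable ℝ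
          (∑ k ∈ s, flux v.1 i c k • rtBasis (M.dir i) (M.simplex i c) k) :=
        Differentiable.sum fun k _ => (hd k).const_smul _
      rw [Finset.sum_insert hk, Finset.sum_insert hk,
        tangentialDiv_add ((hd k).const_smul _) hs, ih, tangentialDiv_smul _ (hd k),
        tangentialDiv_rtBasis, finrank_dir]
  rw [← h Finset.univ, ← eq_sum_flux]

/-- Gauss's theorem on each cell, through `facetArea_eq`; it reduces the divergence to fluxes and
areas. -/
theorem bForm_apply (r : W M) (p : Q M) :
    bForm M r p = -∑ i, ∑ c, p i c * ((∑ k, flux (total M r).1 i c k * facetArea M i c k) +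
      ∫ x in body (M.simplex i c), jump r.2 i x ∂μHE[M.dim i]) := by
  change -∑ i, ∑ c, ∫ x in body (M.simplex i c), p i c * mixedDiv r i c x ∂μHE[M.dim i] = _
  congr 1
  refine Finset.sum_congr rfl fun i _ => Finset.sum_congr rfl fun c _ => ?_
  rw [integral_const_mul]
  congr 1
  simp only [mixedDiv, tangentialDiv_eq]
  have hc : ∀ C : ℝ, IntegrableOn (fun _ : E n => C) (body (M.simplex i c)) μHE[M.dim i] :=
    fun C => integrableOn_const (measure_body_lt_top _).ne
  rw [integral_add (hc _) (integrableOn_jump _ _ _),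
    setIntegral_const, smul_eq_mul, Finset.mul_sum]
  congr 1
  refine Finset.sum_congr rfl fun k _ => ?_
  rw [← facetArea_eq]
  ring

/-- The factor `facetArea` makes the identity hold on points too: there the flux is 0 whatever `g`
is, but so is the area. -/
theorem flux_ofFlux (g : ∀ i, M.Cell i → Fin (M.dim i + 1) → ℝ) (i : M.Sub) (c : M.Cell i)
    (k : Fin (M.dim i + 1)) :
    flux (ofFlux g) i c k * facetArea M i c k = g i c k * facetArea M i c k := by
  by_cases h0 : M.dim i = 0
  · rw [facetArea, facet_eq_empty h0]
    simp
  · have : NeZero (M.dim i) := ⟨h0⟩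
    rw [flux, normalTrace_ofFlux g i c k (facetBarycenter_mem _ k)]

/-- The facets of all cells. -/
abbrev FacetIndex (M : MixedDimMesh n) : Type := Σ i : M.Sub, M.Cell i × Fin (M.dim i + 1)

/-- Supplies test functions with zero mortar part: the three conditions say that the prescribed
fluxes are those of a field in `V0`. -/
theorem exists_bForm_eq (f : FacetIndex M → ℝ)
    (h1 : ∀ i c k c' k', M.kind i c k = .interior c' k' → f ⟨i, c, k⟩ + f ⟨i, c', k'⟩ = 0)
    (h2 : ∀ i c k, M.kind i c k = .neumann → f ⟨i, c, k⟩ = 0)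
    (h3 : ∀ i c k e, M.kind i c k = .mortar e → f ⟨i, c, k⟩ = 0) :
    ∃ r : W M, ∀ p, bForm M r p =
      -∑ x : FacetIndex M, f x * (p x.1 x.2.1 * facetArea M x.1 x.2.1 x.2.2) := by
  let v : V M := ⟨ofFlux fun i c k => f ⟨i, c, k⟩, ofFlux_mem h1 h2⟩
  have hv : v ∈ V0 M := fun i c k e hk x hx => by
    rw [normalTrace_ofFlux _ i c k hx, h3 i c k e hk]
  refine ⟨(⟨v, hv⟩, 0), fun p => ?_⟩
  rw [bForm_apply, Fintype.sum_sigma]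
  congr 1
  refine Finset.sum_congr rfl fun i _ => ?_
  rw [Fintype.sum_prod_type]
  refine Finset.sum_congr rfl fun c _ => ?_
  have ht : total M (⟨v, hv⟩, 0) = v := by simp [total]
  have hj : ∀ x, jump (0 : Lam M) i x = 0 := fun x => by
    simpa using jump_smul 0 (0 : Lam M) i x
  simp only [ht, hj, integral_zero, add_zero, v, flux_ofFlux, Finset.mul_sum]
  refine Finset.sum_congr rfl fun k _ => ?_
  ring

/-- Test with a unit flux that leaves `c` through the shared facet and enters `c'`; the two sides of
the facet have the same positive area. -/
theorem eq_of_interior {p : Q M} (hp : ∀ r, bForm M r p = 0) {i : M.Sub} {c c' : M.Cell i}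
    {k k' : Fin (M.dim i + 1)} (h : M.kind i c k = .interior c' k') : p i c = p i c' := by
  classical
  have h' := M.interior_symm i c k c' k' h
  obtain ⟨hne, hf⟩ := M.interior_shared i c k c' k' h
  have h0 : M.dim i ≠ 0 := fun h0 => by
    have := M.kind_point i c k h0
    simp [h] at this
  let a : FacetIndex M := ⟨i, c, k⟩
  let b : FacetIndex M := ⟨i, c', k'⟩
  have hab : a ≠ b := by
    intro h
    simp only [a, b, Sigma.mk.injEq, heq_eq_eq, true_and, Prod.mk.injEq] at h
    exact hne h.1
  let f : FacetIndex M → ℝ := fun x => (if x = a then 1 else 0) - (if x = b then 1 else 0)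
  have hfz : ∀ x, x ≠ a → x ≠ b → f x = 0 := fun x h1 h2 => by simp [f, h1, h2]
  have hfa : f a = 1 := by simp [f, hab]
  have hfb : f b = -1 := by simp [f, hab.symm]
  have hkind : ∀ j d l, (∀ d' l', M.kind j d l ≠ .interior d' l') →
      f ⟨j, d, l⟩ = 0 := by
    intro j d l hk
    refine hfz _ ?_ ?_
    · intro h1
      change (⟨j, d, l⟩ : FacetIndex M) = ⟨i, c, k⟩ at h1
      cases h1
      exact hk _ _ h
    · intro h2
      change (⟨j, d, l⟩ : FacetIndex M) = ⟨i, c', k'⟩ at h2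
      cases h2
      exact hk _ _ h'
  -- Continuity of the normal component: passing to the other side of a facet is an involution that
  -- exchanges `a` and `b`, so every other interior pair avoids both.
  obtain ⟨r, hr⟩ := exists_bForm_eq f (by
    intro j d l d' l' hk
    have hk' := M.interior_symm _ _ _ _ _ hk
    by_cases h1 : (⟨j, d, l⟩ : FacetIndex M) = a
    · change (⟨j, d, l⟩ : FacetIndex M) = ⟨i, c, k⟩ at h1
      cases h1
      rw [h] at hk
      cases hk
      change f a + f b = 0
      rw [hfa, hfb]; norm_num
    by_cases h2 : (⟨j, d, l⟩ : FacetIndex M) = b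
    · change (⟨j, d, l⟩ : FacetIndex M) = ⟨i, c', k'⟩ at h2
      cases h2
      rw [h'] at hk
      cases hk
      change f b + f a = 0
      rw [hfa, hfb]; norm_num
    have h3 : (⟨j, d', l'⟩ : FacetIndex M) ≠ a := by
      intro h3
      change (⟨j, d', l'⟩ : FacetIndex M) = ⟨i, c, k⟩ at h3
      cases h3
      rw [h] at hk'
      cases hk'
      exact h2 rfl
    have h4 : (⟨j, d', l'⟩ : FacetIndex M) ≠ b := by
      intro h4
      change (⟨j, d', l'⟩ : FacetIndex M) = ⟨i, c', k'⟩ at h4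
      cases h4
      rw [h'] at hk'
      cases hk'
      exact h1 rfl
    rw [hfz _ h1 h2, hfz _ h3 h4, add_zero])
    (fun j d l hk => hkind j d l fun _ _ => by simp [hk])
    (fun j d l e hk => hkind j d l fun _ _ => by simp [hk])
  have h5 := hr p
  rw [hp r] at h5
  simp only [f, sub_mul, ite_mul, one_mul, zero_mul, Finset.sum_sub_distrib,
    Finset.sum_ite_eq', Finset.mem_univ, if_true, a, b] at h5
  have harea : facetArea M i c k = facetArea M i c' k' := by rw [facetArea, facetArea, hf]
  have hpos := facetArea_pos i c' k' h0
  rw [harea] at h5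
  refine mul_right_cancel₀ hpos.ne' ?_
  linarith

/-- Test with a unit flux through this facet alone, which `V0` leaves unconstrained. -/
theorem eq_zero_of_dirichlet {p : Q M} (hp : ∀ r, bForm M r p = 0) {i : M.Sub} {c : M.Cell i}
    {k : Fin (M.dim i + 1)} (h : M.kind i c k = .dirichlet) : p i c = 0 := by
  classical
  have h0 : M.dim i ≠ 0 := fun h0 => by
    have := M.kind_point i c k h0
    simp [h] at this
  let a : FacetIndex M := ⟨i, c, k⟩
  let f : FacetIndex M → ℝ := fun x => if x = a then 1 else 0
  have hkind : ∀ j d l, M.kind j d l ≠ .dirichlet → f ⟨j, d, l⟩ = 0 := by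
    intro j d l hk
    refine if_neg ?_
    intro h1
    change (⟨j, d, l⟩ : FacetIndex M) = ⟨i, c, k⟩ at h1
    cases h1
    exact hk h
  obtain ⟨r, hr⟩ := exists_bForm_eq f
    (fun j d l d' l' hk => by
      rw [hkind j d l (by simp [hk]),
        hkind j d' l' (by simp [M.interior_symm _ _ _ _ _ hk]), add_zero])
    (fun j d l hk => hkind j d l (by simp [hk]))
    (fun j d l e hk => hkind j d l (by simp [hk]))
  have h5 := hr p
  rw [hp r] at h5
  simp only [f, ite_mul, one_mul, zero_mul, Finset.sum_ite_eq', Finset.mem_univ, if_true, a,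
    zero_eq_neg] at h5
  exact (mul_eq_zero.1 h5).resolve_right (facetArea_pos i c k h0).ne'

/-! ### Coupling through the interfaces -/

theorem measureReal_iUnion_eq_sum {X ι : Type*} [MeasurableSpace X] [Fintype ι] {μ : Measure X}
    {S : ι → Set X} (hm : ∀ i, MeasurableSet (S i)) (hfin : ∀ i, μ (S i) < ⊤)
    (hd : Pairwise fun i j => μ (S i ∩ S j) = 0) : μ.real (⋃ i, S i) = ∑ i, μ.real (S i) := by
  rw [Measure.real, measure_iUnion₀ hd fun i => (hm i).nullMeasurableSet, tsum_fintype,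
    ENNReal.toReal_sum fun i _ => (hfin i).ne]
  rfl

/-- The mortar cells cover the lower-dimensional subdomain with null overlaps. Used for facets of
the upper mesh and for cells of the lower mesh, this links three meshes that need not match. -/
theorem sum_measureReal_inter_msimplex (e : M.Iface) {S : Set (E n)} (hS : MeasurableSet S)
    (hsub : S ⊆ ⋃ c, body (M.simplex (M.low e) c)) :
    ∑ m, (μHE[M.dim (M.low e)] : Measure (E n)).real (S ∩ body (M.msimplex e m)) =
      (μHE[M.dim (M.low e)] : Measure (E n)).real S := by
  rw [← measureReal_iUnion_eq_sum, ← Set.inter_iUnion, M.msimplex_cover e,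
    Set.inter_eq_left.2 hsub]
  · exact fun m => hS.inter (isCompact_body _).measurableSet
  · exact fun m => (measure_mono Set.inter_subset_right).trans_lt (measure_body_lt_top _)
  · intro m m' hmm
    refine measure_mono_null ?_ (measure_body_inter _ _ (M.msimplex_disjoint e hmm))
    exact Set.inter_subset_inter Set.inter_subset_right Set.inter_subset_right

theorem sum_measureReal_cells (i : M.Sub) :
    ∑ c, (μHE[M.dim i] : Measure (E n)).real (body (M.simplex i c)) =
      (μHE[M.dim i] : Measure (E n)).real (⋃ c, body (M.simplex i c)) := by
  rw [measureReal_iUnion_eq_sum]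
  · exact fun c => (isCompact_body _).measurableSet
  · exact fun _ => measure_body_lt_top _
  · intro c c' hc
    refine measure_body_inter _ _ (M.disjoint_cells (i := ⟨i, c⟩) (j := ⟨i, c'⟩) ?_)
    simpa using hc

theorem measureReal_cells_pos (i : M.Sub) :
    0 < ∑ c, (μHE[M.dim i] : Measure (E n)).real (body (M.simplex i c)) :=
  Finset.sum_pos (fun _ _ => measureReal_body_pos _) Finset.univ_nonempty

open Classical in
theorem sum_facetArea (e : M.Iface) :
    ∑ c, ∑ k, (if M.kind (M.up e) c k = .mortar e then facetArea M (M.up e) c k else 0) =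
      (μHE[M.dim (M.low e)] : Measure (E n)).real (⋃ c, body (M.simplex (M.low e) c)) := by
  -- `facetArea` uses the measure of dimension `dim (up e) - 1`, the right-hand side that of
  -- dimension `dim (low e)`.
  have hd : M.dim (M.up e) - 1 = M.dim (M.low e) := by rw [M.dim_up]; rfl
  have : NeZero (M.dim (M.up e)) := ⟨by rw [M.dim_up]; omega⟩
  rw [← Fintype.sum_prod_type'
    (f := fun c k => if M.kind (M.up e) c k = .mortar e then facetArea M (M.up e) c k else 0),
    ← Finset.sum_filter, ← Finset.sum_subtype_eq_sum_filter, Finset.subtype_univ,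
    ← M.mortar_cover e]
  have h : (⋃ (c : M.Cell (M.up e)) (k) (_ : M.kind (M.up e) c k = .mortar e),
      facet (M.simplex (M.up e) c) k) =
      ⋃ s : {s : M.Cell (M.up e) × Fin (M.dim (M.up e) + 1) //
        M.kind (M.up e) s.1 s.2 = .mortar e}, facet (M.simplex (M.up e) s.1.1) s.1.2 := by
    ext x
    simp
  rw [h, ← hd, measureReal_iUnion_eq_sum]
  · rfl
  · exact fun s => (isCompact_facet _ _).measurableSet
  · exact fun s => measure_facet_lt_top _ _
  · intro s t hst
    exact measure_inter_eq_zero (convex_facet _ _) (convex_facet _ _)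
      (finrank_vectorSpan_facet _ _) (finrank_vectorSpan_facet _ _) (M.mortar_disjoint e hst)

open Classical in
/-- The characteristic function of an interface. -/
def ifaceIndicator (e : M.Iface) : Lam M := fun e' _ => if e' = e then 1 else 0

open Classical in
-- The projection takes means over facets, hence preserves the constant 1, even though the mortar
-- mesh does not fit the facets.
theorem extCoeff_ifaceIndicator (e : M.Iface) (i : M.Sub) (c : M.Cell i) (k : Fin (M.dim i + 1)) :
    extCoeff (ifaceIndicator e) i c k = if M.kind i c k = .mortar e then 1 else 0 := by
  by_cases h : M.kind i c k = .mortar e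
  · obtain rfl := M.mortar_up i c k e h
    have : NeZero (M.dim (M.up e)) := ⟨by rw [M.dim_up]; omega⟩
    have hd : M.dim (M.up e) - 1 = M.dim (M.low e) := by rw [M.dim_up]; rfl
    have hpos : 0 < (μHE[M.dim (M.low e)] : Measure (E n)).real
        (facet (M.simplex (M.up e) c) k) := by
      have := facetArea_pos (M.up e) c k (NeZero.ne _)
      rwa [facetArea, hd] at this
    have hsub : facet (M.simplex (M.up e) c) k ⊆ ⋃ c, body (M.simplex (M.low e) c) := by
      rw [← M.mortar_cover e]
      intro x hx
      simp only [Set.mem_iUnion]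
      exact ⟨c, k, h, hx⟩
    rw [if_pos h, extCoeff, h]
    simp only [proj, ifaceIndicator, if_true, one_mul]
    rw [← Finset.sum_div, sum_measureReal_inter_msimplex e (isCompact_facet _ _).measurableSet hsub,
      div_self hpos.ne']
  · rw [if_neg h, extCoeff]
    cases hk : M.kind i c k with
    | mortar e' =>
      have : e' ≠ e := by
        rintro rfl
        exact h hk
      simp [proj, ifaceIndicator, this]
    | _ => rfl

open Classical in
theorem jump_ifaceIndicator (e : M.Iface) (i : M.Sub) (x : E n) :
    jump (ifaceIndicator e) i x =
      -if M.low e = i then mortarFun (ifaceIndicator e) e x else 0 := by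
  rw [jump, Finset.sum_eq_single e]
  · intro e' _ he
    simp [mortarFun, ifaceIndicator, he]
  · simp

/-- The sum of indicators exceeds 1 where mortar cells overlap, but only on a null set. -/
theorem integral_mortarFun_ifaceIndicator (e : M.Iface) (c : M.Cell (M.low e)) :
    ∫ x in body (M.simplex (M.low e) c), mortarFun (ifaceIndicator e) e x
      ∂μHE[M.dim (M.low e)] =
      (μHE[M.dim (M.low e)] : Measure (E n)).real (body (M.simplex (M.low e) c)) := by
  have hm : ∀ m, MeasurableSet (body (M.msimplex e m)) := fun m => (isCompact_body _).measurableSet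
  rw [← sum_measureReal_inter_msimplex e (isCompact_body _).measurableSet
    (Set.subset_iUnion (fun c => body (M.simplex (M.low e) c)) c)]
  simp only [mortarFun]
  have hc : ∀ m, IntegrableOn ((body (M.msimplex e m)).indicator fun _ => ifaceIndicator e e m)
      (body (M.simplex (M.low e) c)) μHE[M.dim (M.low e)] := fun m =>
    IntegrableOn.indicator (integrableOn_const (measure_body_lt_top _).ne) (hm m)
  rw [integral_finsetSum _ fun m _ => hc m]
  refine Finset.sum_congr rfl fun m _ => ?_
  rw [setIntegral_indicator (hm m), setIntegral_const, smul_eq_mul]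
  simp [ifaceIndicator]

/-- Conservation of mass: for a unit mortar flux on `e`, the amount that leaves `up e` and the
amount that enters `low e` both equal the measure of `low e`. -/
theorem eq_of_iface {p : Q M} (hp : ∀ r, bForm M r p = 0) {π : M.Sub → ℝ}
    (hπ : ∀ i c, p i c = π i) (e : M.Iface) : π (M.up e) = π (M.low e) := by
  classical
  have h := hp (0, ifaceIndicator e)
  have ht : (total M (0, ifaceIndicator e)).1 = ofFlux (extCoeff (ifaceIndicator e)) := by
    simp only [total, LinearMap.coprod_apply, map_zero, zero_add]
    rfl
  rw [bForm_apply] at h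
  simp only [ht, flux_ofFlux, hπ, mul_add, Finset.sum_add_distrib, ← Finset.mul_sum] at h
  have hA : ∑ i, π i * ∑ c, ∑ k, extCoeff (ifaceIndicator e) i c k * facetArea M i c k =
      π (M.up e) * (μHE[M.dim (M.low e)] : Measure (E n)).real
        (⋃ c, body (M.simplex (M.low e) c)) := by
    simp only [extCoeff_ifaceIndicator, ite_mul, one_mul, zero_mul]
    rw [Finset.sum_eq_single (M.up e), sum_facetArea]
    · intro i _ hi
      have : ∀ c k, M.kind i c k ≠ .mortar e := fun c k hk => hi (M.mortar_up i c k e hk)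
      simp [this]
    · simp
  have hB : ∑ i, π i * ∑ c, ∫ x in body (M.simplex i c), jump (ifaceIndicator e) i x
      ∂μHE[M.dim i] = -(π (M.low e) * (μHE[M.dim (M.low e)] : Measure (E n)).real
        (⋃ c, body (M.simplex (M.low e) c))) := by
    simp only [jump_ifaceIndicator, integral_neg]
    rw [Finset.sum_eq_single (M.low e)]
    · simp only [if_true, integral_mortarFun_ifaceIndicator, Finset.sum_neg_distrib,
        sum_measureReal_cells, mul_neg]
    · intro i _ hi
      simp [hi.symm]
    · simp
  rw [hA, hB] at h
  have hpos := measureReal_cells_pos (M.low e)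
  rw [sum_measureReal_cells] at hpos
  refine mul_right_cancel₀ hpos.ne' ?_
  linarith

theorem eq_of_eqvGen {α β : Type*} {r : α → α → Prop} {f : α → β} (h : ∀ a b, r a b → f a = f b)
    {a b : α} (hab : Relation.EqvGen r a b) : f a = f b := by
  induction hab with
  | rel a b hr => exact h a b hr
  | refl a => rfl
  | symm a b _ ih => exact ih.symm
  | trans a b c _ _ ih ih' => exact ih.trans ih'

/-- The divergence is onto: a pressure that is orthogonal to all divergences vanishes. -/
theorem eq_zero_of_bForm {p : Q M} (hp : ∀ r, bForm M r p = 0) : p = 0 := by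
  have h1 : ∀ i c c', p i c = p i c' := fun i c c' =>
    eq_of_eqvGen (f := p i) (fun a b ⟨_, _, h⟩ => eq_of_interior hp h) (M.sub_connected i c c')
  let π : M.Sub → ℝ := fun i => p i (Classical.arbitrary _)
  have hπ : ∀ i c, p i c = π i := fun i c => h1 i c _
  have h2 : ∀ i j, π i = π j := fun i j =>
    eq_of_eqvGen (f := π) (fun a b ⟨e, ha, hb⟩ => by
      rw [← ha, ← hb]
      exact eq_of_iface hp hπ e) (M.connected i j)
  obtain ⟨i, c, k, -, hk⟩ := M.exists_dirichlet
  have h3 := eq_zero_of_dirichlet hp hk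
  funext j d
  rw [hπ, h2 j i, ← hπ i c, h3]
  rfl

/-! ### Inverses and operator norms -/

section Inverse

variable {U U' : Type} [AddCommMonoid U] [Module ℝ U] [AddCommMonoid U'] [Module ℝ U']
  {T : U →ₗ[ℝ] U'}

theorem inv_eq (h : Function.Bijective T) :
    inv T = (LinearEquiv.ofBijective T h).symm.toLinearMap := dif_pos h

theorem apply_inv (h : Function.Bijective T) (y : U') : T (inv T y) = y := by
  rw [inv_eq h]
  exact (LinearEquiv.ofBijective T h).apply_symm_apply y

theorem bijective_inv (h : Function.Bijective T) : Function.Bijective (inv T) := by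
  rw [inv_eq h]
  exact (LinearEquiv.ofBijective T h).symm.bijective

/-- Where `N x = 0` the quotient is `0 / 0`, which is 0 in `ENNReal`. -/
theorem opNorm_le {N : U → ℝ} {T : U →ₗ[ℝ] U} {C : ℝ} (hC : 0 ≤ C) (h : ∀ x, N (T x) ≤ C * N x) :
    opNorm N T ≤ ENNReal.ofReal C := by
  refine iSup_le fun x => ENNReal.div_le_of_le_mul ?_
  rw [← ENNReal.ofReal_mul hC]
  exact ENNReal.ofReal_le_ofReal (h x)

end Inverse

theorem bijective_of_definite {U : Type} [AddCommGroup U] [Module ℝ U] [FiniteDimensional ℝ U]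
    {T : U →ₗ[ℝ] Module.Dual ℝ U} (h : ∀ u, u ≠ 0 → T u u ≠ 0) : Function.Bijective T := by
  have hi : Function.Injective T := by
    refine (injective_iff_map_eq_zero T).2 fun u hu => ?_
    by_contra h0
    exact h u h0 (by rw [hu]; rfl)
  exact ⟨hi, (LinearMap.injective_iff_surjective_of_finrank_eq_finrank
    Subspace.dual_finrank_eq.symm).1 hi⟩

/-- The Cauchy–Schwarz inequality for a symmetric positive semidefinite form. -/
theorem sq_le_of_symm {U : Type*} [AddCommGroup U] [Module ℝ U] {B : U →ₗ[ℝ] U →ₗ[ℝ] ℝ}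
    (hs : ∀ x y, B x y = B y x) (hp : ∀ x, 0 ≤ B x x) (x y : U) :
    B x y ^ 2 ≤ B x x * B y y := by
  have h := LinearMap.BilinForm.apply_mul_apply_le_of_forall_zero_le B hp x y
  rw [hs y x] at h
  linarith [sq (B x y)]

/-! ### Saddle point problems with a diagonal preconditioner -/

section Saddle

variable {W Q : Type} [AddCommGroup W] [Module ℝ W] [AddCommGroup Q] [Module ℝ Q]

/-- The hypotheses on the forms of a saddle point problem: `a` and its approximation `d` are
symmetric and positive definite, and `b` is nondegenerate in its second argument. -/
structure IsSaddle (a d : W →ₗ[ℝ] W →ₗ[ℝ] ℝ) (b : W →ₗ[ℝ] Q →ₗ[ℝ] ℝ) : Prop where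
  a_symm : ∀ w r, a w r = a r w
  d_symm : ∀ w r, d w r = d r w
  a_pos : ∀ r, r ≠ 0 → 0 < a r r
  d_pos : ∀ r, r ≠ 0 → 0 < d r r
  eq_zero : ∀ p, (∀ r, b r p = 0) → p = 0

/-- The gradient that belongs to the forms `d` and `b`. -/
def saddleGrad (d : W →ₗ[ℝ] W →ₗ[ℝ] ℝ) (b : W →ₗ[ℝ] Q →ₗ[ℝ] ℝ) : Q →ₗ[ℝ] W :=
  inv (U' := Module.Dual ℝ W) d ∘ₗ b.flip

/-- The Schur complement of the approximation. -/
def saddleSchur (d : W →ₗ[ℝ] W →ₗ[ℝ] ℝ) (b : W →ₗ[ℝ] Q →ₗ[ℝ] ℝ) : Q →ₗ[ℝ] Module.Dual ℝ Q :=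
  b ∘ₗ saddleGrad d b

/-- The operator of the saddle point problem. -/
def saddleOp (a : W →ₗ[ℝ] W →ₗ[ℝ] ℝ) (b : W →ₗ[ℝ] Q →ₗ[ℝ] ℝ) :
    W × Q →ₗ[ℝ] Module.Dual ℝ W × Module.Dual ℝ Q :=
  (a.coprod b.flip).prod ((-b).coprod 0)

/-- The block diagonal preconditioner. -/
def saddlePrecond (a d : W →ₗ[ℝ] W →ₗ[ℝ] ℝ) (b : W →ₗ[ℝ] Q →ₗ[ℝ] ℝ) :
    Module.Dual ℝ W × Module.Dual ℝ Q →ₗ[ℝ] W × Q :=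
  inv (LinearMap.prodMap (M₃ := Module.Dual ℝ W) a (saddleSchur d b))

/-- The inner product of the weighted norm. -/
def saddleInner (a d : W →ₗ[ℝ] W →ₗ[ℝ] ℝ) (b : W →ₗ[ℝ] Q →ₗ[ℝ] ℝ) :
    W × Q →ₗ[ℝ] W × Q →ₗ[ℝ] ℝ :=
  a.compl₁₂ (LinearMap.fst ℝ _ _) (LinearMap.fst ℝ _ _) +
    d.compl₁₂ (saddleGrad d b ∘ₗ LinearMap.snd ℝ _ _) (saddleGrad d b ∘ₗ LinearMap.snd ℝ _ _)

/-- The weighted norm. -/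
def saddleNorm (a d : W →ₗ[ℝ] W →ₗ[ℝ] ℝ) (b : W →ₗ[ℝ] Q →ₗ[ℝ] ℝ) (x : W × Q) : ℝ :=
  Real.sqrt (a x.1 x.1 + d (saddleGrad d b x.2) (saddleGrad d b x.2))

/-- The composite form. -/
def saddleComp (a d : W →ₗ[ℝ] W →ₗ[ℝ] ℝ) (b : W →ₗ[ℝ] Q →ₗ[ℝ] ℝ) (x y : W × Q) : ℝ :=
  a x.1 y.1 + d (saddleGrad d b x.2) y.1 + d (saddleGrad d b y.2) x.1

theorem saddleInner_apply (a d : W →ₗ[ℝ] W →ₗ[ℝ] ℝ) (b : W →ₗ[ℝ] Q →ₗ[ℝ] ℝ) (x y : W × Q) :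
    saddleInner a d b x y = a x.1 y.1 + d (saddleGrad d b x.2) (saddleGrad d b y.2) := rfl

theorem nonneg_of_pos {U : Type*} [AddCommGroup U] [Module ℝ U] {B : U →ₗ[ℝ] U →ₗ[ℝ] ℝ}
    (h : ∀ r, r ≠ 0 → 0 < B r r) (r : U) : 0 ≤ B r r := by
  by_cases h0 : r = 0
  · simp [h0]
  · exact (h r h0).le

namespace IsSaddle

variable {a d : W →ₗ[ℝ] W →ₗ[ℝ] ℝ} {b : W →ₗ[ℝ] Q →ₗ[ℝ] ℝ}

theorem a_nonneg (H : IsSaddle a d b) (r : W) : 0 ≤ a r r := nonneg_of_pos H.a_pos r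

theorem d_nonneg (H : IsSaddle a d b) (r : W) : 0 ≤ d r r := nonneg_of_pos H.d_pos r

theorem a_sq_le (H : IsSaddle a d b) (w r : W) : a w r ^ 2 ≤ a w w * a r r :=
  sq_le_of_symm H.a_symm H.a_nonneg w r

theorem d_sq_le (H : IsSaddle a d b) (w r : W) : d w r ^ 2 ≤ d w w * d r r :=
  sq_le_of_symm H.d_symm H.d_nonneg w r

theorem bijective_a [FiniteDimensional ℝ W] (H : IsSaddle a d b) :
    Function.Bijective (a : W →ₗ[ℝ] Module.Dual ℝ W) :=
  bijective_of_definite fun u hu => (H.a_pos u hu).ne'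

theorem bijective_d [FiniteDimensional ℝ W] (H : IsSaddle a d b) :
    Function.Bijective (d : W →ₗ[ℝ] Module.Dual ℝ W) :=
  bijective_of_definite fun u hu => (H.d_pos u hu).ne'

theorem saddleOp_fst (x : W × Q) (r : W) : (saddleOp a b x).1 r = a x.1 r + b r x.2 := rfl

theorem saddleOp_snd (x : W × Q) (q : Q) : (saddleOp a b x).2 q = -b x.1 q := by
  simp [saddleOp]

theorem inner_symm (H : IsSaddle a d b) (x y : W × Q) :
    saddleInner a d b x y = saddleInner a d b y x := by
  rw [saddleInner_apply, saddleInner_apply, H.a_symm, H.d_symm]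

theorem norm_nonneg (x : W × Q) : 0 ≤ saddleNorm a d b x := Real.sqrt_nonneg _

theorem norm_zero : saddleNorm a d b 0 = 0 := by simp [saddleNorm]

/-- The reflection that absorbs the sign of `-B` in the second row is an isometry. -/
theorem norm_flip (r : W) (q : Q) : saddleNorm a d b (r, -q) = saddleNorm a d b (r, q) := by
  simp only [saddleNorm, map_neg, LinearMap.neg_apply, neg_neg]

theorem comp_symm (H : IsSaddle a d b) (x y : W × Q) :
    saddleComp a d b x y = saddleComp a d b y x := by
  simp only [saddleComp, H.a_symm x.1 y.1]
  ring

variable [FiniteDimensional ℝ W]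

theorem d_grad (H : IsSaddle a d b) (p : Q) (r : W) : d (saddleGrad d b p) r = b r p :=
  LinearMap.congr_fun (apply_inv H.bijective_d (b.flip p)) r

theorem grad_ne_zero (H : IsSaddle a d b) {p : Q} (hp : p ≠ 0) : saddleGrad d b p ≠ 0 := by
  intro h
  refine hp (H.eq_zero p fun r => ?_)
  rw [← H.d_grad, h, map_zero, LinearMap.zero_apply]

/-- The Schur complement is thus the Gram operator of the pressure part of the weighted norm. -/
theorem schur_apply (H : IsSaddle a d b) (p q : Q) :
    saddleSchur d b p q = d (saddleGrad d b q) (saddleGrad d b p) :=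
  (H.d_grad q (saddleGrad d b p)).symm

theorem bijective_schur [FiniteDimensional ℝ Q] (H : IsSaddle a d b) :
    Function.Bijective (saddleSchur d b) :=
  bijective_of_definite fun p hp => by
    rw [H.schur_apply]
    exact (H.d_pos _ (H.grad_ne_zero hp)).ne'

/-- For a kernel element, the first row tested with its own flux loses the `b`-term by the second
row, so the flux is 0; nondegeneracy of `b` then removes the pressure. -/
theorem bijective_saddleOp [FiniteDimensional ℝ Q] (H : IsSaddle a d b) :
    Function.Bijective (saddleOp a b) := by
  have hi : Function.Injective (saddleOp a b) := by
    refine (injective_iff_map_eq_zero _).2 fun x hx => ?_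
    have h1 : ∀ r, a x.1 r + b r x.2 = 0 := fun r => by
      rw [← saddleOp_fst, hx]; rfl
    have h2 : ∀ q, b x.1 q = 0 := fun q => by
      rw [← neg_eq_zero, ← saddleOp_snd (a := a), hx]; rfl
    have h3 : x.1 = 0 := by
      by_contra h0
      have := h1 x.1
      rw [h2, add_zero] at this
      exact (H.a_pos _ h0).ne' this
    have h4 : x.2 = 0 := H.eq_zero _ fun r => by
      have := h1 r
      rwa [h3, map_zero, LinearMap.zero_apply, zero_add] at this
    exact Prod.ext h3 h4
  have hrank : Module.finrank ℝ (W × Q) =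
      Module.finrank ℝ (Module.Dual ℝ W × Module.Dual ℝ Q) := by
    rw [Module.finrank_prod, Module.finrank_prod, Subspace.dual_finrank_eq,
      Subspace.dual_finrank_eq]
  exact ⟨hi, (LinearMap.injective_iff_surjective_of_finrank_eq_finrank hrank).1 hi⟩

theorem inner_pos (H : IsSaddle a d b) (x : W × Q) (hx : x ≠ 0) : 0 < saddleInner a d b x x := by
  rw [saddleInner_apply]
  by_cases h : x.1 = 0
  · have h2 : x.2 ≠ 0 := fun h2 => hx (Prod.ext h h2)
    exact add_pos_of_nonneg_of_pos (H.a_nonneg _) (H.d_pos _ (H.grad_ne_zero h2))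
  · exact add_pos_of_pos_of_nonneg (H.a_pos _ h) (H.d_nonneg _)

theorem inner_nonneg (H : IsSaddle a d b) (x : W × Q) : 0 ≤ saddleInner a d b x x :=
  nonneg_of_pos H.inner_pos x

theorem norm_pos (H : IsSaddle a d b) (x : W × Q) (hx : x ≠ 0) : 0 < saddleNorm a d b x :=
  Real.sqrt_pos.2 (H.inner_pos x hx)

theorem norm_sq (H : IsSaddle a d b) (x : W × Q) :
    saddleNorm a d b x ^ 2 = saddleInner a d b x x :=
  Real.sq_sqrt (H.inner_nonneg x)

theorem inner_le (H : IsSaddle a d b) (x y : W × Q) :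
    saddleInner a d b x y ≤ saddleNorm a d b x * saddleNorm a d b y := by
  refine le_of_abs_le (abs_le_of_sq_le_sq ?_ (mul_nonneg (norm_nonneg x) (norm_nonneg y)))
  rw [mul_pow, H.norm_sq, H.norm_sq]
  exact sq_le_of_symm H.inner_symm H.inner_nonneg x y

/-- Continuity of the composite form. -/
theorem abs_comp_le {C : ℝ} (hC : 0 ≤ C) (H : IsSaddle a d b) (h : ∀ r, d r r ≤ C * a r r)
    (x y : W × Q) : |saddleComp a d b x y| ≤
      (1 + 2 * Real.sqrt C) * saddleNorm a d b x * saddleNorm a d b y := by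
  have ha : |a x.1 y.1| ≤ saddleNorm a d b x * saddleNorm a d b y := by
    refine abs_le_of_sq_le_sq ?_ (mul_nonneg (norm_nonneg x) (norm_nonneg y))
    rw [mul_pow, H.norm_sq, H.norm_sq]
    refine (H.a_sq_le _ _).trans ?_
    have h1 := H.d_nonneg (saddleGrad d b x.2)
    have h2 := H.d_nonneg (saddleGrad d b y.2)
    exact mul_le_mul (by rw [saddleInner_apply]; linarith) (by rw [saddleInner_apply]; linarith)
      (H.a_nonneg _) (H.inner_nonneg _)
  -- Cauchy–Schwarz in `d`, then `d ≤ C a` on the flux; each of the two coupling terms contributes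
  -- `√C`.
  have hd : ∀ x y : W × Q, |d (saddleGrad d b x.2) y.1| ≤
      Real.sqrt C * (saddleNorm a d b x * saddleNorm a d b y) := by
    intro x y
    refine abs_le_of_sq_le_sq ?_ (mul_nonneg (Real.sqrt_nonneg _)
      (mul_nonneg (norm_nonneg x) (norm_nonneg y)))
    rw [mul_pow, mul_pow, H.norm_sq, H.norm_sq, Real.sq_sqrt hC]
    refine (H.d_sq_le _ _).trans ?_
    have h1 := H.a_nonneg x.1
    have h2 := H.d_nonneg (saddleGrad d b y.2)
    have h3 : d y.1 y.1 ≤ C * saddleInner a d b y y :=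
      (h y.1).trans (mul_le_mul_of_nonneg_left (by rw [saddleInner_apply]; linarith) hC)
    calc _ ≤ saddleInner a d b x x * (C * saddleInner a d b y y) :=
          mul_le_mul (by rw [saddleInner_apply]; linarith) h3 (H.d_nonneg _) (H.inner_nonneg _)
      _ = _ := by ring
  have h2 := hd x y
  have h3 := hd y x
  calc |saddleComp a d b x y| ≤ |a x.1 y.1| + |d (saddleGrad d b x.2) y.1| +
        |d (saddleGrad d b y.2) x.1| := abs_add_three _ _ _
    _ ≤ saddleNorm a d b x * saddleNorm a d b y +
        Real.sqrt C * (saddleNorm a d b x * saddleNorm a d b y) +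
        Real.sqrt C * (saddleNorm a d b y * saddleNorm a d b x) := by linarith
    _ = _ := by ring

/-- Stability of the composite form. -/
theorem infSup (H : IsSaddle a d b) (h : ∀ r, a r r ≤ 4 * d r r) :
    ((1 / 16 : ℝ) : EReal) ≤ ⨅ (y : W × Q) (_ : y ≠ 0), ⨆ (x : W × Q) (_ : x ≠ 0),
      ((saddleComp a d b x y / (saddleNorm a d b x * saddleNorm a d b y) : ℝ) : EReal) := by
  refine le_iInf₂ fun y hy => ?_
  obtain ⟨r, q⟩ := y
  set g := saddleGrad d b q with hg
  -- The component `-q` cancels the coupling `d g r`, and `g / 4` adds `d g g / 4`, which controls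
  -- the pressure. The weight is small enough for the cross term `a g r / 4` to be absorbed.
  let x : W × Q := (r + (1 / 4 : ℝ) • g, -q)
  have hx : x ≠ 0 := by
    intro h0
    have h2 : q = 0 := by simpa [x] using congrArg Prod.snd h0
    have h1 : r = 0 := by simpa [x, hg, h2] using congrArg Prod.fst h0
    exact hy (by rw [h1, h2]; rfl)
  refine le_trans ?_ (le_iSup₂ (f := fun (x : W × Q) (_ : x ≠ 0) =>
    ((saddleComp a d b x (r, q) / (saddleNorm a d b x * saddleNorm a d b (r, q)) : ℝ) : EReal))
    x hx)
  rw [EReal.coe_le_coe_iff, le_div_iff₀ (mul_pos (H.norm_pos x hx) (H.norm_pos _ hy))]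
  set A := a r r with hAr
  set B := d g g with hB
  set t := a g r with ht
  have hA0 : 0 ≤ A := H.a_nonneg r
  have hB0 : 0 ≤ B := H.d_nonneg g
  have hgg : a g g ≤ 4 * B := h g
  have htsq : t ^ 2 ≤ 4 * B * A :=
    (H.a_sq_le g r).trans (mul_le_mul_of_nonneg_right hgg hA0)
  -- Weighted AM–GM: `(2 A + B / 2)² - 4 A B = (2 A - B / 2)²`.
  have htabs : |t| ≤ 2 * A + B / 2 :=
    abs_le_of_sq_le_sq (by nlinarith [sq_nonneg (2 * A - B / 2)]) (by positivity)
  obtain ⟨ht1, ht2⟩ := abs_le.1 htabs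
  have hL : saddleComp a d b x (r, q) = A + t / 4 + B / 4 := by
    simp only [saddleComp, x, map_add, map_smul, map_neg, LinearMap.add_apply,
      LinearMap.smul_apply, LinearMap.neg_apply, smul_eq_mul, ← hg, ← hB, ← ht, ← hAr]
    ring
  have hN : saddleNorm a d b (r, q) ^ 2 = A + B := H.norm_sq _
  have hX : saddleNorm a d b x ^ 2 = A + t / 2 + a g g / 16 + B := by
    rw [H.norm_sq, saddleInner_apply]
    simp only [x, map_add, map_smul, map_neg, LinearMap.add_apply, LinearMap.smul_apply,
      LinearMap.neg_apply, smul_eq_mul, ← hg, ← hB, ← ht, ← hAr, H.a_symm r g, neg_neg]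
    ring
  have hN0 : 0 ≤ saddleNorm a d b (r, q) := norm_nonneg _
  have hXN : saddleNorm a d b x ≤ 2 * saddleNorm a d b (r, q) := by
    refine le_of_sq_le_sq ?_ (by positivity)
    rw [mul_pow, hN, hX]
    linarith
  rw [hL]
  -- The form is at least `A / 2 + B / 8 ≥ (A + B) / 8`; since the norm of `x` is at most twice that
  -- of `(r, q)`, the constant is `1 / 16`.
  nlinarith [mul_le_mul_of_nonneg_right hXN hN0]

variable [FiniteDimensional ℝ Q]

theorem bijective_prodMap (H : IsSaddle a d b) :
    Function.Bijective (LinearMap.prodMap (M₃ := Module.Dual ℝ W) a (saddleSchur d b)) := by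
  rw [LinearMap.coe_prodMap]
  exact H.bijective_a.prodMap H.bijective_schur

/-- The preconditioned operator represents the composite form, up to a reflection. -/
theorem inner_precond (H : IsSaddle a d b) (x : W × Q) (r : W) (q : Q) :
    saddleInner a d b ((saddlePrecond a d b ∘ₗ saddleOp a b) x) (r, q) =
      saddleComp a d b x (r, -q) := by
  set y := (saddlePrecond a d b ∘ₗ saddleOp a b) x with hy
  have h : LinearMap.prodMap (M₃ := Module.Dual ℝ W) a (saddleSchur d b) y = saddleOp a b x :=
    apply_inv H.bijective_prodMap _
  have h1 : a y.1 r = a x.1 r + b r x.2 := by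
    rw [← saddleOp_fst, ← h]
    rfl
  have h2 : d (saddleGrad d b q) (saddleGrad d b y.2) = -b x.1 q := by
    rw [← saddleOp_snd (a := a), ← h, ← H.schur_apply]
    rfl
  rw [saddleInner_apply, h1, H.d_symm, h2, ← H.d_grad, ← H.d_grad, saddleComp]
  simp only [map_neg, LinearMap.neg_apply]

theorem condNumber_le (H : IsSaddle a d b) {α β : ℝ} (hα : 0 < α) (hβ : 0 < β)
    (h1 : ∀ x y, |saddleComp a d b x y| ≤ α * saddleNorm a d b x * saddleNorm a d b y)
    (h2 : (β : EReal) ≤ ⨅ (y : W × Q) (_ : y ≠ 0), ⨆ (x : W × Q) (_ : x ≠ 0),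
      ((saddleComp a d b x y / (saddleNorm a d b x * saddleNorm a d b y) : ℝ) : EReal)) :
    condNumber (saddleNorm a d b) (saddlePrecond a d b ∘ₗ saddleOp a b) ≤
      ENNReal.ofReal (α / β) := by
  set T := saddlePrecond a d b ∘ₗ saddleOp a b with hT
  have hbij : Function.Bijective T :=
    (bijective_inv H.bijective_prodMap).comp H.bijective_saddleOp
  have hup : ∀ x, saddleNorm a d b (T x) ≤ α * saddleNorm a d b x := by
    intro x
    by_cases h0 : T x = 0
    · rw [h0, norm_zero]
      exact mul_nonneg hα.le (norm_nonneg x)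
    -- Tested with the reflected `T x`, the composite form is the squared norm of `T x`.
    have h := le_of_abs_le (h1 x ((T x).1, -(T x).2))
    rw [← H.inner_precond, norm_flip, ← hT, ← H.norm_sq, sq] at h
    exact le_of_mul_le_mul_right h (H.norm_pos _ h0)
  have hlow : ∀ x, β * saddleNorm a d b x ≤ saddleNorm a d b (T x) := by
    intro x
    by_cases h0 : x = 0
    · rw [h0, map_zero, norm_zero, mul_zero]
    have hx := H.norm_pos x h0
    have h : (β : EReal) ≤ ((saddleNorm a d b (T x) / saddleNorm a d b x : ℝ) : EReal) := by
      refine (le_iInf₂_iff.1 h2 x h0).trans (iSup₂_le fun z hz => ?_)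
      have hz' := H.norm_pos z hz
      -- The inf-sup condition takes the supremum over the first argument; symmetry of the form
      -- makes `z` the test element.
      rw [EReal.coe_le_coe_iff, div_le_div_iff₀ (mul_pos hz' hx) hx, H.comp_symm]
      have h3 := H.inner_precond x z.1 (-z.2)
      rw [neg_neg, ← hT] at h3
      have h4 := H.inner_le (T x) (z.1, -z.2)
      rw [norm_flip, h3] at h4
      calc _ ≤ saddleNorm a d b (T x) * saddleNorm a d b z * saddleNorm a d b x :=
            mul_le_mul_of_nonneg_right h4 hx.le
        _ = _ := by ring
    rwa [EReal.coe_le_coe_iff, le_div_iff₀ hx] at h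
  have hinv : ∀ y, saddleNorm a d b (inv T y) ≤ β⁻¹ * saddleNorm a d b y := by
    intro y
    have h := hlow (inv T y)
    rw [apply_inv hbij] at h
    rw [inv_mul_eq_div, le_div_iff₀ hβ, mul_comm]
    exact h
  rw [condNumber, div_eq_mul_inv, ENNReal.ofReal_mul hα.le]
  exact mul_le_mul' (opNorm_le hα.le hup) (opNorm_le (inv_nonneg.2 hβ.le) hinv)

end IsSaddle

end Saddle

end

/-! ### Application to the mixed-dimensional problem. -/

/-- The forms of the discrete problem form a saddle point problem. -/
theorem isSaddle {n : ℕ} (hn : n ≤ 3) {M : MixedDimMesh n} {P : Params M} {τ : ℝ}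
    (hτ : P.AnisotropyLE τ) : IsSaddle (W := W M) (Q := Q M) (aForm P) (aDForm P) (bForm M) where
  a_symm := aForm_symm P
  d_symm := aDForm_symm P
  a_pos _ hr := aForm_pos hτ hr
  d_pos r hr := by
    have h1 := aForm_pos hτ hr
    have h2 := aForm_self_le P hn r
    linarith
  eq_zero _ hp := eq_zero_of_bForm hp

theorem continuity_of_isSaddle {n : ℕ} {M : MixedDimMesh n} {P : Params M} {C : ℝ}
    (H : IsSaddle (W := W M) (Q := Q M) (aForm P) (aDForm P) (bForm M)) (hC : 0 ≤ C)
    (h : ∀ r, aDForm P r r ≤ C * aForm P r r) : Continuity P (1 + 2 * Real.sqrt C) := by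
  have h1 := H.abs_comp_le hC h
  generalize 1 + 2 * Real.sqrt C = α at h1 ⊢
  exact h1

end MixedDim

theorem mainTheorem4 (σ τ : ℝ) :
    ∃ α β : ℝ, 0 < α ∧ 0 < β ∧
      ∀ (n : ℕ), n = 2 ∨ n = 3 → ∀ (M : MixedDim.MixedDimMesh n) (P : MixedDim.Params M),
        M.ShapeRegular σ → P.AnisotropyLE τ →
          -- all inverses exist, and the weighted norm is positive definite
          (Function.Bijective (MixedDim.opA P) ∧ Function.Bijective (MixedDim.opDA P) ∧
            Function.Bijective (MixedDim.opS P) ∧ Function.Bijective (MixedDim.sysOp P) ∧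
            ∀ x : MixedDim.X M, x ≠ 0 → 0 < MixedDim.triNorm P x) ∧
          -- the composite form is well-posed with the uniform constants
          (MixedDim.Continuity P α ∧ MixedDim.InfSup P β) ∧
          -- the bound of the condition number with the uniform constants
          MixedDim.condNumber (MixedDim.triNorm P) (MixedDim.precond P ∘ₗ MixedDim.sysOp P) ≤
            ENNReal.ofReal (α / β) ∧
          -- the bound with any constants of continuity and inf-sup
          ∀ α' β' : ℝ, 0 < α' → 0 < β' → MixedDim.Continuity P α' → MixedDim.InfSup P β' →
            MixedDim.condNumber (MixedDim.triNorm P) (MixedDim.precond P ∘ₗ MixedDim.sysOp P) ≤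
              ENNReal.ofReal (α' / β') := by
  have hC : 0 ≤ 264 * σ ^ 2 * |τ| + 1 := by positivity
  -- Only `α` depends on `σ` and `τ`, through `aDForm_self_le`; the inf-sup constant uses only `a ≤
  -- 4 a^D` and is universal.
  refine ⟨1 + 2 * Real.sqrt (264 * σ ^ 2 * |τ| + 1), 1 / 16, by positivity, by norm_num, ?_⟩
  intro n hn M P hσ hτ
  have hn3 : n ≤ 3 := by omega
  have H := MixedDim.isSaddle hn3 hτ
  have h1 : MixedDim.Continuity P (1 + 2 * Real.sqrt (264 * σ ^ 2 * |τ| + 1)) :=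
    MixedDim.continuity_of_isSaddle H hC (MixedDim.aDForm_self_le hn3 hσ hτ)
  have h2 : MixedDim.InfSup P (1 / 16) := H.infSup (MixedDim.aForm_self_le P hn3)
  -- The concrete operators, norm and composite form are by definition the abstract ones for `aForm
  -- P`, `aDForm P` and `bForm M`.
  exact ⟨⟨H.bijective_a, H.bijective_d, H.bijective_schur, H.bijective_saddleOp, H.norm_pos⟩,
    ⟨h1, h2⟩, H.condNumber_le (by positivity) (by norm_num) h1 h2,
    fun α' β' hα hβ => H.condNumber_le hα hβ⟩
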